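/- **Mosaics.** The mosaic tiles are unit squares carrying arcs that join midpoints of their sides: type I is blank; the type II tiles carry one arc joining two adjacent sides (IIa: left–bottom, IIb: bottom–right, IIc: right–top, IId: top–left); IIIa and IIIb carry one straight arc (IIIa: left–right, IIIb: bottom–top); the type IV tiles carry two disjoint arcs (IVa: left–bottom and right–top, IVb: bottom–right and top–left); Va and Vb are the two crossings. There is one further tile, type 0, a square with a dot and no arcs, which is not used in mosaics. An $n$-mosaic is an $n\times n$ array of mosaic tiles. It is a link mosaic if every arc ending on a side of a tile is continued by an arc in the tile across that side (in particular no arc ends on the boundary of the board); it is then a projection of a link. It is a mosaic for the knot $K$ if that link is equivalent to $K$, where knots are (unoriented) simple closed polygons in $\mathbb R^3$ and equivalence is generated by triangle moves. Let $S$ be the set of interior tiles, those not along the boundary of the board. **Dual.** A dual $D$ of a mosaic is obtained by replacing every tile in $S$ as follows: V by I; IV by type 0; IIIa $\leftrightarrow$ IIIb; IIa $\leftrightarrow$ IIc; IIb $\leftrightarrow$ IId; and each I by IVa or IVb (either choice being allowed at each such tile). Let $l$ be the number of tiles of $D$ that are not blank (not of type I), $l'$ the number of those that are also not of type 0, and $l''$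 the number of tiles of $D$ of type IV. Put $T=(l,l',l'')$, which does not depend on the choice of $D$, and compare such triples lexicographically. A loop in $D$ is a closed curve in $S$ formed by arcs of $D$; its length is the number of tiles in which it is contained. A bubble is a loop of length $4$. **Theorem.** Let $K$ be a knot and let $M_n$ be an $n$-mosaic for $K$ with dual $D$ and ordered triple $T$. If $T$ is minimal among the ordered triples of all $n$-mosaics for $K$, then $D$ contains no bubble. Moreover, whenever $D$ contains a bubble, there is another $n$-mosaic for the same knot $K$ whose ordered triple is strictly smaller than $T$. -/

import Mathlib

namespace KnotMosaic

/-- The four sides of a tile. -/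
inductive Side
  | left | right | bottom | top
  deriving DecidableEq

/-- The opposite side. -/
def Side.opp : Side → Side
  | .left => .right
  | .right => .left
  | .bottom => .top
  | .top => .bottom

/-- A position on the board: `(row, column)`, with rows counted from the bottom and columns counted
from the left, both starting at `1`. -/
abbrev Pos := ℤ × ℤ

/-- The position that shares the side `s` with the position `p`. -/
def nbr (p : Pos) : Side → Pos
  | .left => (p.1, p.2 - 1)
  | .right => (p.1, p.2 + 1)
  | .bottom => (p.1 - 1, p.2)
  | .top => (p.1 + 1, p.2)

/-- The tiles. `dot` is the type 0 tile (a dot in the center), which occurs only in duals; the other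
eleven are the mosaic tiles of types I (blank), II (one quarter turn), III (one straight arc),
IV (two quarter turns) and V (a crossing). -/
inductive Tile
  | dot | I | IIa | IIb | IIc | IId | IIIa | IIIb | IVa | IVb | Va | Vb
  deriving DecidableEq

/-- The arcs on a tile, each listed by the two sides that it joins. -/
def Tile.arcs : Tile → List (Side × Side)
  | .dot => []
  | .I => []
  | .IIa => [(.left, .bottom)]
  | .IIb => [(.bottom, .right)]
  | .IIc => [(.right, .top)]
  | .IId => [(.top, .left)]
  | .IIIa => [(.left, .right)]
  | .IIIb => [(.bottom, .top)]
  | .IVa => [(.left, .bottom), (.right, .top)]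
  | .IVb => [(.bottom, .right), (.top, .left)]
  | .Va => [(.left, .right), (.bottom, .top)]
  | .Vb => [(.left, .right), (.bottom, .top)]

/-- Some arc of the tile `t` runs between the sides `s` and `s'`. -/
def Tile.Joins (t : Tile) (s s' : Side) : Prop :=
  (s, s') ∈ t.arcs ∨ (s', s) ∈ t.arcs

/-- Some arc of the tile `t` ends on the side `s`. -/
def Tile.Meets (t : Tile) (s : Side) : Prop :=
  ∃ s', t.Joins s s'

/-- The positions of an `n × n` board. -/
noncomputable def board (n : ℕ) : Finset Pos :=
  Finset.Icc (1 : ℤ) n ×ˢ Finset.Icc (1 : ℤ) n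

/-- The interior `S` of an `n × n` board: the positions that do not lie along its boundary. -/
noncomputable def interior (n : ℕ) : Finset Pos :=
  Finset.Icc (2 : ℤ) (n - 1) ×ˢ Finset.Icc (2 : ℤ) (n - 1)

/-- An `n`-mosaic: an `n × n` array of mosaic tiles. For convenience the array is
extended by blank tiles to all positions. -/
structure Mosaic (n : ℕ) where
  /-- the tile at each position -/
  tile : Pos → Tile
  /-- the type 0 tile is not a mosaic tile -/
  ne_dot : ∀ p, tile p ≠ .dot
  /-- there is nothing outside the board -/
  blank_outside : ∀ p, p ∉ board n → tile p = .I

/-- A link mosaic: the tiles are suitably connected, that is, an arc that ends on a side of a tile is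
continued by an arc of the tile on the other side (in particular no arc ends on the boundary of the
board, since there are only blank tiles beyond it). -/
def Mosaic.IsLinkMosaic {n : ℕ} (M : Mosaic n) : Prop :=
  ∀ p s, (M.tile p).Meets s ↔ (M.tile (nbr p s)).Meets s.opp

/-! ### The link of a mosaic, and knots in space -/

/-- Euclidean three-space (only its affine structure is used). -/
abbrev Space := ℝ × ℝ × ℝ

/-- The point at height `z` over the center of the tile at `p`; the tile is the unit square around
that center. -/
noncomputable def center (p : Pos) (z : ℝ) : Space := (p.2, p.1, z)

/-- The midpoint of the side `s` of the tile at `p`, at height `0`. -/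
noncomputable def mid (p : Pos) : Side → Space
  | .left => (p.2 - 1 / 2, p.1, 0)
  | .right => (p.2 + 1 / 2, p.1, 0)
  | .bottom => (p.2, p.1 - 1 / 2, 0)
  | .top => (p.2, p.1 + 1 / 2, 0)

/-- The straight arc in the tile at `p` that joins the midpoints of two sides at height `0`. -/
def chord (p : Pos) (s s' : Side) : Set Space :=
  segment ℝ (mid p s) (mid p s')

/-- The arc in the tile at `p` that joins the midpoints of two sides
and passes above the center at height `1`. -/
def bridge (p : Pos) (s s' : Side) : Set Space :=
  segment ℝ (mid p s) (center p 1) ∪ segment ℝ (center p 1) (mid p s')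

/-- The part of the link in space over the tile `t` at position `p`. The horizontal strand is the
over-strand of `Va`, and the vertical strand is the over-strand of `Vb`. -/
def Tile.curve (p : Pos) : Tile → Set Space
  | .dot => ∅
  | .I => ∅
  | .IIa => chord p .left .bottom
  | .IIb => chord p .bottom .right
  | .IIc => chord p .right .top
  | .IId => chord p .top .left
  | .IIIa => chord p .left .right
  | .IIIb => chord p .bottom .top
  | .IVa => chord p .left .bottom ∪ chord p .right .top
  | .IVb => chord p .bottom .right ∪ chord p .top .left
  | .Va => bridge p .left .right ∪ chord p .bottom .top
  | .Vb => chord p .left .right ∪ bridge p .bottom .top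

/-- The polygonal link in space of which a link mosaic is a projection. -/
def Mosaic.link {n : ℕ} (M : Mosaic n) : Set Space :=
  ⋃ p : Pos, (M.tile p).curve p

/-- A (polygonal) knot: a simple closed polygon in space. -/
def IsKnot (K : Set Space) : Prop :=
  ∃ (k : ℕ) (v : ZMod k → Space), 3 ≤ k ∧ Function.Injective v ∧
    (∀ i j, i ≠ j → segment ℝ (v i) (v (i + 1)) ∩ segment ℝ (v j) (v (j + 1)) ⊆
      {v i, v (i + 1)} ∩ {v j, v (j + 1)}) ∧
    K = ⋃ i, segment ℝ (v i) (v (i + 1))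

/-- A triangle move (Δ-move): a straight segment `ab` contained in `K` is replaced by the two other
sides `ac`, `cb` of a non-degenerate triangle that meets `K` in the segment `ab` only. -/
def TriangleMove (K K' : Set Space) : Prop :=
  ∃ a b c : Space, AffineIndependent ℝ ![a, b, c] ∧
    convexHull ℝ {a, b, c} ∩ K = segment ℝ a b ∧
    K' = (K \ segment ℝ a b) ∪ (segment ℝ a c ∪ segment ℝ c b)

/-- Equivalence of polygonal knots and links in space (combinatorial isotopy): they are related by
finitely many triangle moves and inverses of triangle moves. -/
def Isotopic : Set Space → Set Space → Prop :=
  Relation.EqvGen TriangleMove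

/-- `M` is a mosaic for `K`: it is a link mosaic, and the link of which it is a projection is
equivalent to `K`. If `K` is a knot, then that link has one component,
so that `M` is a knot mosaic. -/
def Mosaic.IsMosaicFor {n : ℕ} (M : Mosaic n) (K : Set Space) : Prop :=
  M.IsLinkMosaic ∧ Isotopic M.link K

/-! ### The dual of a mosaic -/

/-- The tile `d` may replace the mosaic tile `r` in a dual. -/
def IsDualTile : Tile → Tile → Prop
  | .dot, _ => False
  | .I, d => d = .IVa ∨ d = .IVb
  | .IIa, d => d = .IIc
  | .IIb, d => d = .IId
  | .IIc, d => d = .IIa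
  | .IId, d => d = .IIb
  | .IIIa, d => d = .IIIb
  | .IIIb, d => d = .IIIa
  | .IVa, d => d = .dot
  | .IVb, d => d = .dot
  | .Va, d => d = .I
  | .Vb, d => d = .I

/-- A choice of tiles for the interior of an `n × n` board. -/
abbrev InteriorTiling (n : ℕ) := interior n → Tile

/-- `D` is a dual of the mosaic `M` (one for each choice between `IVa` and `IVb` at the blank tiles
of the interior). -/
def IsDual {n : ℕ} (M : Mosaic n) (D : InteriorTiling n) : Prop :=
  ∀ p : interior n, IsDualTile (M.tile p) (D p)

/-- The ordered triple `T = (l, l', l'')`, in the lexicographic order: `l` counts the tiles of `D`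
that are not blank, `l'` those among them that are not of type 0,
and `l''` the tiles of type IV. -/
noncomputable def triple {n : ℕ} (D : InteriorTiling n) : ℕ ×ₗ ℕ ×ₗ ℕ :=
  toLex
    ((Finset.univ.filter fun p => D p ≠ .I).card,
      toLex ((Finset.univ.filter fun p => D p ≠ .I ∧ D p ≠ .dot).card,
        (Finset.univ.filter fun p => D p = .IVa ∨ D p = .IVb).card))

/-- The mosaic `M`, with dual `D`, minimizes the ordered triple
among all `n`-mosaics for `K`. -/
def IsMinimal {n : ℕ} (K : Set Space) (M : Mosaic n) (D : InteriorTiling n) : Prop :=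
  M.IsMosaicFor K ∧ IsDual M D ∧
    ∀ (M' : Mosaic n) (D' : InteriorTiling n), M'.IsMosaicFor K → IsDual M' D' →
      triple D ≤ triple D'

/-- A loop in `D`, traversed once: in the cyclically ordered `i`-th step it crosses the tile
`tile i` of the interior along an arc of `D` from the side `enter i` to the side `exit i`, and
passes from there into the next tile. -/
structure Loop {n : ℕ} (D : InteriorTiling n) where
  /-- the number of arcs -/
  size : ℕ
  size_pos : 0 < size
  /-- the tiles in the order in which they are visited -/
  tile : ZMod size → interior n
  /-- the side through which each tile is entered -/
  enter : ZMod size → Side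
  /-- the side through which each tile is left -/
  exit : ZMod size → Side
  joins : ∀ i, (D (tile i)).Joins (enter i) (exit i)
  tile_succ : ∀ i, (tile (i + 1) : Pos) = nbr (tile i) (exit i)
  enter_succ : ∀ i, enter (i + 1) = (exit i).opp
  once : Function.Injective fun i => (tile i, enter i)

/-- The length of a loop: the number of tiles in which it is contained. -/
noncomputable def Loop.length {n : ℕ} {D : InteriorTiling n} (L : Loop D) : ℕ :=
  (Set.range L.tile).ncard

/-- A bubble is a loop of length `4` (such a loop runs around a common corner of four tiles, so these
are of types II and IV). -/
def Loop.IsBubble {n : ℕ} {D : InteriorTiling n} (L : Loop D) : Prop :=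
  L.length = 4

end KnotMosaic

namespace KnotMosaic

/-! ### Triangle moves -/

/-! A bubble runs around a common corner of four interior tiles (`Loop.IsBubble.exists_corner`). A
quarter arc of the dual at a corner comes from a mosaic tile with no arc ending on the two sides at
that corner (`IsDualTile.not_meets`), so in the mosaic no arc crosses any of the four sides that
meet there: there is a gap in the link.

In terms of the mosaic, `l` counts the interior tiles that are not crossings, `l'` those that are
neither crossings nor of type IV, and `l''` the blank ones (`IsDualTile.iff`). Two moves lower the
triple. If one of the four tiles around a gap is not blank, it carries exactly the arc around its
far corner; a first Reidemeister move turns this tile into a crossing whose kink closes up through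
the other three tiles, so `l` drops (`improvable_of_kink`). If a strand runs alongside two adjacent
blank interior tiles, it can be pushed into them; crossings and type IV tiles stay in place and
`l''` drops (`improvable_of_push`).

If neither move is available, the tiles around the gap are blank, and blankness spreads: two
adjacent blank interior tiles force the adjacent pairs on both sides to be blank
(`blank_of_not_improvable`). This fills two rows, then all interior columns, then the whole board
(`blank_of_domino`). But a mosaic for a knot is not blank, because triangle moves preserve
nonemptiness. So a bubble always allows a smaller triple, which also excludes bubbles from minimal
mosaics. -/

lemma mem_triangle {a b c q : Space} (hq : q ∈ convexHull ℝ {a, b, c}) :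
    ∃ x y z : ℝ, 0 ≤ x ∧ 0 ≤ y ∧ 0 ≤ z ∧ x + y + z = 1 ∧ x • a + y • b + z • c = q := by
  rw [convexHull_insert (by simp), convexHull_pair, mem_convexJoin] at hq
  obtain ⟨a', ha', d, ⟨u, v, hu, hv, huv, rfl⟩, ⟨x, w, hx, hw, hxw, rfl⟩⟩ := hq
  rw [Set.mem_singleton_iff] at ha'
  subst ha'
  refine ⟨x, w * u, w * v, hx, by positivity, by positivity, by
    rw [add_assoc, ← mul_add, huv, mul_one, hxw], ?_⟩
  rw [smul_add, smul_smul, smul_smul, add_assoc]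

/-- If a set meets a triangle at most in two of its vertices, then the side between these may be
replaced by the other two sides. -/
lemma isotopic_flip {R : Set Space} (a b c : Space)
    (hi : ∀ x y z : ℝ, x + y + z = 0 → x • a + y • b + z • c = 0 → x = 0 ∧ y = 0 ∧ z = 0)
    (hR : ∀ x y z : ℝ, 0 ≤ x → 0 ≤ y → 0 ≤ z → x + y + z = 1 → x • a + y • b + z • c ∈ R →
      z = 0 ∧ (x = 0 ∨ y = 0)) :
    Isotopic (R ∪ segment ℝ a b) (R ∪ (segment ℝ a c ∪ segment ℝ c b)) := by
  have hR' : ∀ q ∈ convexHull ℝ {a, b, c}, q ∈ R → q = a ∨ q = b := by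
    intro q hq hqR
    obtain ⟨x, y, z, hx, hy, hz, h1, rfl⟩ := mem_triangle hq
    obtain ⟨rfl, rfl | rfl⟩ := hR x y z hx hy hz h1 hqR
    · right
      have : y = 1 := by linarith
      simp [this]
    · left
      have : x = 1 := by linarith
      simp [this]
  have hab : segment ℝ a b ⊆ convexHull ℝ {a, b, c} := by
    rw [← convexHull_pair]
    exact convexHull_mono (by intro q; simp; tauto)
  refine Relation.EqvGen.rel _ _ ⟨a, b, c, ?_, ?_, ?_⟩
  · rw [affineIndependent_iff_of_fintype]
    intro w hw hs
    rw [Finset.univ.weightedVSub_eq_linear_combination hw] at hs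
    simp only [Fin.sum_univ_three] at hw hs
    obtain ⟨h0, h1, h2⟩ := hi _ _ _ hw hs
    intro i
    fin_cases i <;> assumption
  · ext q
    constructor
    · rintro ⟨hq, hq' | hq'⟩
      · rcases hR' q hq hq' with rfl | rfl
        · exact left_mem_segment ℝ _ _
        · exact right_mem_segment ℝ _ _
      · exact hq'
    · exact fun hq => ⟨hab hq, Or.inr hq⟩
  -- The vertices `a` and `b` may lie in `R`. Removing the segment `ab` deletes them, but the two
  -- new sides restore them.
  · ext q
    simp only [Set.mem_union, Set.mem_sdiff]
    constructor
    · rintro (hq | hq)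
      · by_cases h : q ∈ segment ℝ a b
        · rcases hR' q (hab h) hq with rfl | rfl
          · exact Or.inr (Or.inl (left_mem_segment ℝ _ _))
          · exact Or.inr (Or.inr (right_mem_segment ℝ _ _))
        · exact Or.inl ⟨Or.inl hq, h⟩
      · exact Or.inr hq
    · rintro (⟨hq | hq, h⟩ | hq)
      · exact Or.inl hq
      · exact absurd hq h
      · exact Or.inr hq

lemma Isotopic.trans {A B C : Set Space} (h : Isotopic A B) (h' : Isotopic B C) : Isotopic A C :=
  Relation.EqvGen.trans _ _ _ h h'

lemma Isotopic.symm {A B : Set Space} (h : Isotopic A B) : Isotopic B A :=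
  Relation.EqvGen.symm _ _ h

/-- Triangle moves are affine notions. Orientation plays no role, so reflected local coordinates are
allowed as well. -/
lemma Isotopic.image {A B : Set Space} (h : Isotopic A B) (f : Space →ᵃ[ℝ] Space)
    (hf : Function.Injective f) : Isotopic (f '' A) (f '' B) := by
  induction h with
  | rel A B h =>
    obtain ⟨a, b, c, hi, hA, rfl⟩ := h
    refine Relation.EqvGen.rel _ _ ⟨f a, f b, f c, ?_, ?_, ?_⟩
    · convert hi.map' f hf using 1
      ext i : 1
      fin_cases i <;> rfl
    · rw [← image_segment, ← hA, Set.image_inter hf, f.image_convexHull]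
      simp [Set.image_insert_eq]
    · simp only [Set.image_union, Set.image_sdiff hf, image_segment]
  | refl A => exact Relation.EqvGen.refl _
  | symm A B _ ih => exact ih.symm
  | trans A B C _ _ ih ih' => exact ih.trans ih'

/-- Both sides of a triangle move contain the vertex `a`. -/
lemma Isotopic.nonempty_iff {A B : Set Space} (h : Isotopic A B) : A.Nonempty ↔ B.Nonempty := by
  induction h with
  | rel A B h =>
    obtain ⟨a, b, c, -, hA, rfl⟩ := h
    have ha : a ∈ segment ℝ a b := left_mem_segment ℝ _ _
    refine ⟨fun _ => ⟨a, Or.inr (Or.inl (left_mem_segment ℝ _ _))⟩, fun _ => ⟨a, ?_⟩⟩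
    rw [← hA] at ha
    exact ha.2
  | refl A => rfl
  | symm A B _ ih => exact ih.symm
  | trans A B C _ _ ih ih' => exact ih.trans ih'

lemma IsKnot.nonempty {K : Set Space} (hK : IsKnot K) : K.Nonempty := by
  obtain ⟨k, v, -, -, -, rfl⟩ := hK
  exact ⟨v 0, Set.mem_iUnion.2 ⟨0, left_mem_segment ℝ _ _⟩⟩

/-! ### Two local isotopies in standard coordinates -/

lemma abs_add_abs_le_of {u v w : ℝ} (h₁ : u + v ≤ w) (h₂ : u - v ≤ w) (h₃ : -u + v ≤ w)
    (h₄ : -u - v ≤ w) : |u| + |v| ≤ w := by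
  rcases abs_cases u with ⟨h, -⟩ | ⟨h, -⟩ <;> rcases abs_cases v with ⟨h', -⟩ | ⟨h', -⟩ <;>
    linarith

/-- The first Reidemeister move in standard coordinates: an arc around the corner opposite to the
gap between four tiles is replaced by a curve around that gap. -/
lemma isotopic_kink {R : Set Space}
    (h0 : ∀ q ∈ R, |q.1| + |q.2.1| ≤ 1 / 2 → q = (-1 / 2, 0, 0) ∨ q = (0, -1 / 2, 0))
    (h1 : ∀ q ∈ R, ¬ |q.1 - 1 / 2| + |q.2.1 - 1 / 2| ≤ 1 / 2) :
    Isotopic (R ∪ segment ℝ (-1 / 2, 0, 0) (0, -1 / 2, 0))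
      (R ∪ ((segment ℝ (-1 / 2, 0, 0) (0, 0, 1) ∪ segment ℝ (0, 0, 1) (1 / 2, 0, 0)) ∪
          segment ℝ (0, 1 / 2, 0) (0, -1 / 2, 0) ∪
        (segment ℝ (1 / 2, 0, 0) (1, 1 / 2, 0) ∪ segment ℝ (1, 1 / 2, 0) (1 / 2, 1, 0) ∪
          segment ℝ (1 / 2, 1, 0) (0, 1 / 2, 0)))) := by
  let L : Space := (-1 / 2, 0, 0)
  let B : Space := (0, -1 / 2, 0)
  let E : Space := (1 / 2, 0, 0)
  let T : Space := (0, 1 / 2, 0)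
  let C : Space := (0, 0, 1)
  let X : Space := (1, 1 / 2, 0)
  let Y : Space := (1 / 2, 1, 0)
  -- The arc is lifted to `L C B` with `C` at height 1, then `C B` becomes `C T B`, which leaves `T
  -- B` as the lower strand, and `C T` becomes `C E T`, which completes the upper strand `L C E`.
  -- Finally `E T` is moved to `E X Y T`, across the square gap, in two triangles. The assumptions
  -- on `R` ignore the height, so they keep `R` away from the lifted triangles too.
  have m1 : Isotopic (R ∪ segment ℝ L B) (R ∪ (segment ℝ L C ∪ segment ℝ C B)) := by
    apply isotopic_flip
    · intro x y z h h'
      simp [L, B, C] at h'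
      grind
    · rintro x y z hx hy hz h h'
      simp only [L, B, C, Prod.smul_mk, Prod.mk_add_mk, smul_eq_mul] at h'
      rcases h0 _ h' (by apply abs_add_abs_le_of <;> dsimp only <;> linarith) with h | h <;>
        simp at h <;> grind
  have m2 : Isotopic ((R ∪ segment ℝ L C) ∪ segment ℝ C B)
      ((R ∪ segment ℝ L C) ∪ (segment ℝ C T ∪ segment ℝ T B)) := by
    apply isotopic_flip
    · intro x y z h h'
      simp [B, C, T] at h'
      grind
    · rintro x y z hx hy hz h (h' | ⟨u, v, hu, hv, huv, h'⟩)
      · simp only [B, C, T, Prod.smul_mk, Prod.mk_add_mk, smul_eq_mul] at h'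
        rcases h0 _ h' (by apply abs_add_abs_le_of <;> dsimp only <;> linarith) with h | h <;>
          simp at h <;> grind
      · simp [B, C, T, L] at h'
        grind
  have m3 : Isotopic ((R ∪ segment ℝ L C ∪ segment ℝ T B) ∪ segment ℝ C T)
      ((R ∪ segment ℝ L C ∪ segment ℝ T B) ∪ (segment ℝ C E ∪ segment ℝ E T)) := by
    apply isotopic_flip
    · intro x y z h h'
      simp [E, C, T] at h'
      grind
    · rintro x y z hx hy hz h ((h' | ⟨u, v, hu, hv, huv, h'⟩) | ⟨u, v, hu, hv, huv, h'⟩)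
      · simp only [E, C, T, Prod.smul_mk, Prod.mk_add_mk, smul_eq_mul] at h'
        rcases h0 _ h' (by apply abs_add_abs_le_of <;> dsimp only <;> linarith) with h | h <;>
          simp at h <;> grind
      · simp [E, C, T, L] at h'
        grind
      · simp [E, C, T, B] at h'
        grind
  have m4 : Isotopic ((R ∪ segment ℝ L C ∪ segment ℝ T B ∪ segment ℝ C E) ∪ segment ℝ E T)
      ((R ∪ segment ℝ L C ∪ segment ℝ T B ∪ segment ℝ C E) ∪
        (segment ℝ E Y ∪ segment ℝ Y T)) := by
    apply isotopic_flip
    · intro x y z h h'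
      simp [E, Y, T] at h'
      grind
    · rintro x y z hx hy hz h (((h' | ⟨u, v, hu, hv, huv, h'⟩) | ⟨u, v, hu, hv, huv, h'⟩) |
        ⟨u, v, hu, hv, huv, h'⟩)
      · simp only [E, Y, T, Prod.smul_mk, Prod.mk_add_mk, smul_eq_mul] at h'
        exact absurd (by apply abs_add_abs_le_of <;> dsimp only <;> linarith) (h1 _ h')
      · simp [E, C, T, L, Y] at h'
        grind
      · simp [E, T, B, Y] at h'
        grind
      · simp [E, C, T, Y] at h'
        grind
  have m5 : Isotopic ((R ∪ segment ℝ L C ∪ segment ℝ T B ∪ segment ℝ C E ∪ segment ℝ Y T) ∪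
        segment ℝ E Y)
      ((R ∪ segment ℝ L C ∪ segment ℝ T B ∪ segment ℝ C E ∪ segment ℝ Y T) ∪
        (segment ℝ E X ∪ segment ℝ X Y)) := by
    apply isotopic_flip
    · intro x y z h h'
      simp [E, Y, X] at h'
      grind
    · rintro x y z hx hy hz h ((((h' | ⟨u, v, hu, hv, huv, h'⟩) | ⟨u, v, hu, hv, huv, h'⟩) |
        ⟨u, v, hu, hv, huv, h'⟩) | ⟨u, v, hu, hv, huv, h'⟩)
      · simp only [E, Y, X, Prod.smul_mk, Prod.mk_add_mk, smul_eq_mul] at h'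
        exact absurd (by apply abs_add_abs_le_of <;> dsimp only <;> linarith) (h1 _ h')
      · simp [E, C, L, X, Y] at h'
        grind
      · simp [E, T, B, X, Y] at h'
        grind
      · simp [E, C, X, Y] at h'
        grind
      · simp [E, T, X, Y] at h'
        grind
  refine m1.trans ?_
  rw [← Set.union_assoc]
  refine m2.trans ?_
  rw [Set.union_comm (segment ℝ C T), ← Set.union_assoc]
  refine m3.trans ?_
  rw [← Set.union_assoc]
  refine m4.trans ?_
  rw [Set.union_comm (segment ℝ E Y), ← Set.union_assoc]
  convert m5 using 1
  ext q
  simp only [Set.mem_union]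
  tauto

set_option maxHeartbeats 1000000 in
/-- A planar isotopy in standard coordinates: a strand is pushed across the gap between four
tiles. -/
lemma isotopic_push {R : Set Space} {e e' : Space}
    (he : e = (-1 / 2, 0, 0) ∨ e = (0, -1 / 2, 0))
    (he' : e' = (-1 / 2, 1, 0) ∨ e' = (0, 3 / 2, 0))
    (h0 : ∀ q ∈ R, |q.1| + |q.2.1| ≤ 1 / 2 → q = e ∨ q = (0, 1 / 2, 0))
    (h0' : ∀ q ∈ R, |q.1| + |q.2.1 - 1| ≤ 1 / 2 → q = e' ∨ q = (0, 1 / 2, 0))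
    (h1 : ∀ q ∈ R, ¬ |q.1 - 1 / 2| + |q.2.1 - 1 / 2| ≤ 1 / 2) :
    Isotopic (R ∪ (segment ℝ e (0, 1 / 2, 0) ∪ segment ℝ (0, 1 / 2, 0) e'))
      (R ∪ (segment ℝ e (1 / 2, 0, 0) ∪ segment ℝ (1 / 2, 0, 0) (1, 1 / 2, 0) ∪
        segment ℝ (1, 1 / 2, 0) (1 / 2, 1, 0) ∪ segment ℝ (1 / 2, 1, 0) e')) := by
  let E : Space := (1 / 2, 0, 0)
  let T : Space := (0, 1 / 2, 0)
  let X : Space := (1, 1 / 2, 0)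
  let Y : Space := (1 / 2, 1, 0)
  -- The points `T`, `E`, `X`, `Y` are the vertices of the square gap. The path `e T e'` is first
  -- moved to `e E T Y e'` inside the two diamonds, then `E T Y` is replaced by the diagonal `E Y`,
  -- and this by `E X Y`.
  have m1 : Isotopic ((R ∪ segment ℝ T e') ∪ segment ℝ e T)
      ((R ∪ segment ℝ T e') ∪ (segment ℝ e E ∪ segment ℝ E T)) := by
    apply isotopic_flip
    · intro x y z h h'
      rcases he with rfl | rfl <;> simp [T, E] at h' <;> grind
    · rintro x y z hx hy hz h (h' | ⟨u, v, hu, hv, huv, h'⟩)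
      · rcases h0 _ h' (by
          rcases he with rfl | rfl <;>
          simp only [T, E, Prod.smul_mk, Prod.mk_add_mk, smul_eq_mul] <;>
          apply abs_add_abs_le_of <;> linarith) with h | h <;>
        rcases he with rfl | rfl <;> simp [T, E] at h <;> grind
      · rcases he with rfl | rfl <;> rcases he' with rfl | rfl <;> simp [T, E] at h' <;> grind
  have m2 : Isotopic ((R ∪ segment ℝ e E ∪ segment ℝ E T) ∪ segment ℝ T e')
      ((R ∪ segment ℝ e E ∪ segment ℝ E T) ∪ (segment ℝ T Y ∪ segment ℝ Y e')) := by
    apply isotopic_flip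
    · intro x y z h h'
      rcases he' with rfl | rfl <;> simp [T, Y] at h' <;> grind
    · rintro x y z hx hy hz h ((h' | ⟨u, v, hu, hv, huv, h'⟩) | ⟨u, v, hu, hv, huv, h'⟩)
      · rcases h0' _ h' (by
          rcases he' with rfl | rfl <;>
          simp only [T, Y, Prod.smul_mk, Prod.mk_add_mk, smul_eq_mul] <;>
          apply abs_add_abs_le_of <;> linarith) with h | h <;>
        rcases he' with rfl | rfl <;> simp [T, Y] at h <;> grind
      · rcases he with rfl | rfl <;> rcases he' with rfl | rfl <;> simp [T, E, Y] at h' <;> grind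
      · rcases he' with rfl | rfl <;> simp [T, E, Y] at h' <;> grind
  have m3 : Isotopic ((R ∪ segment ℝ e E ∪ segment ℝ Y e') ∪ segment ℝ E Y)
      ((R ∪ segment ℝ e E ∪ segment ℝ Y e') ∪ (segment ℝ E T ∪ segment ℝ T Y)) := by
    apply isotopic_flip
    · intro x y z h h'
      simp [E, Y, T] at h'
      grind
    · rintro x y z hx hy hz h ((h' | ⟨u, v, hu, hv, huv, h'⟩) | ⟨u, v, hu, hv, huv, h'⟩)
      · simp only [E, Y, T, Prod.smul_mk, Prod.mk_add_mk, smul_eq_mul] at h'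
        exact absurd (by apply abs_add_abs_le_of <;> dsimp only <;> linarith) (h1 _ h')
      · rcases he with rfl | rfl <;> simp [E, Y, T] at h' <;> grind
      · rcases he' with rfl | rfl <;> simp [E, Y, T] at h' <;> grind
  have m4 : Isotopic ((R ∪ segment ℝ e E ∪ segment ℝ Y e') ∪ segment ℝ E Y)
      ((R ∪ segment ℝ e E ∪ segment ℝ Y e') ∪ (segment ℝ E X ∪ segment ℝ X Y)) := by
    apply isotopic_flip
    · intro x y z h h'
      simp [E, Y, X] at h'
      grind
    · rintro x y z hx hy hz h ((h' | ⟨u, v, hu, hv, huv, h'⟩) | ⟨u, v, hu, hv, huv, h'⟩)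
      · simp only [E, Y, X, Prod.smul_mk, Prod.mk_add_mk, smul_eq_mul] at h'
        exact absurd (by apply abs_add_abs_le_of <;> dsimp only <;> linarith) (h1 _ h')
      · rcases he with rfl | rfl <;> simp [E, Y, X] at h' <;> grind
      · rcases he' with rfl | rfl <;> simp [E, Y, X] at h' <;> grind
  rw [Set.union_comm (segment ℝ e _), ← Set.union_assoc]
  refine m1.trans ?_
  have e1 : R ∪ segment ℝ T e' ∪ (segment ℝ e E ∪ segment ℝ E T) =
      (R ∪ segment ℝ e E ∪ segment ℝ E T) ∪ segment ℝ T e' := by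
    ext q
    simp only [Set.mem_union]
    tauto
  have e2 : (R ∪ segment ℝ e E ∪ segment ℝ E T) ∪ (segment ℝ T Y ∪ segment ℝ Y e') =
      (R ∪ segment ℝ e E ∪ segment ℝ Y e') ∪ (segment ℝ E T ∪ segment ℝ T Y) := by
    ext q
    simp only [Set.mem_union]
    tauto
  rw [e1]
  refine m2.trans ?_
  rw [e2]
  -- The move across the first half of the gap shortens the path, so it is the inverse of a triangle
  -- move.
  refine m3.symm.trans ?_
  have e3 : (R ∪ segment ℝ e E ∪ segment ℝ Y e') ∪ (segment ℝ E X ∪ segment ℝ X Y) =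
      R ∪ (segment ℝ e E ∪ segment ℝ E X ∪ segment ℝ X Y ∪ segment ℝ Y e') := by
    ext q
    simp only [Set.mem_union]
    tauto
  rw [e3] at m4
  exact m4

/-! ### Sides and tiles -/

instance : Fintype Side := ⟨{.left, .right, .bottom, .top}, fun s => by cases s <;> decide⟩

instance : Fintype Tile :=
  ⟨{.dot, .I, .IIa, .IIb, .IIc, .IId, .IIIa, .IIIb, .IVa, .IVb, .Va, .Vb},
    fun t => by cases t <;> decide⟩

instance (t : Tile) (s s' : Side) : Decidable (t.Joins s s') :=
  inferInstanceAs (Decidable (_ ∨ _))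

instance (t : Tile) (s : Side) : Decidable (t.Meets s) :=
  inferInstanceAs (Decidable (∃ _, _))

instance (r d : Tile) : Decidable (IsDualTile r d) := by
  cases r <;> unfold IsDualTile <;> infer_instance

/-- Two sides that have a common corner. -/
def Side.Perp (s t : Side) : Prop := t ≠ s ∧ t ≠ s.opp

instance (s t : Side) : Decidable (s.Perp t) := inferInstanceAs (Decidable (_ ∧ _))

/-- The crossings. -/
def Tile.IsCrossing (t : Tile) : Prop := t = .Va ∨ t = .Vb

/-- The tiles with two disjoint arcs. -/
def Tile.IsDouble (t : Tile) : Prop := t = .IVa ∨ t = .IVb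

instance (t : Tile) : Decidable t.IsCrossing := inferInstanceAs (Decidable (_ ∨ _))

instance (t : Tile) : Decidable t.IsDouble := inferInstanceAs (Decidable (_ ∨ _))

/-- The tile with a single arc that joins two given distinct sides. -/
def arcTile : Side → Side → Tile
  | .left, .bottom | .bottom, .left => .IIa
  | .bottom, .right | .right, .bottom => .IIb
  | .right, .top | .top, .right => .IIc
  | .top, .left | .left, .top => .IId
  | .left, .right | .right, .left => .IIIa
  | .bottom, .top | .top, .bottom => .IIIb
  | _, _ => .I

/-- Adds an arc that joins the adjacent sides `a` and `b` to a tile that is blank or has only the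
opposite arc. -/
def Tile.addArc (a b : Side) (t : Tile) : Tile :=
  if t = .I then arcTile a b
  else if arcTile a b = .IIa ∨ arcTile a b = .IIc then .IVa else .IVb

@[simp] lemma Side.opp_opp (s : Side) : s.opp.opp = s := by cases s <;> rfl

lemma Side.Perp.ne {s t : Side} (h : s.Perp t) : s ≠ t := fun e => h.1 e.symm

lemma Side.Perp.symm {s t : Side} : s.Perp t → t.Perp s := by revert s t; decide

lemma Side.Perp.opp_left {s t : Side} : s.Perp t → s.opp.Perp t := by revert s t; decide

lemma Side.Perp.opp_right {s t : Side} : s.Perp t → s.Perp t.opp := by revert s t; decide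

lemma Tile.eq_I_iff {t : Tile} (h : t ≠ .dot) : t = .I ↔ ∀ s, ¬ t.Meets s := by
  revert t; decide

lemma not_meets_I (s : Side) : ¬ Tile.I.Meets s := by revert s; decide

lemma Tile.Joins.ne {t : Tile} {a b : Side} : t.Joins a b → a ≠ b := by revert t a b; decide

lemma meets_arcTile {a b c : Side} : a ≠ b → ((arcTile a b).Meets c ↔ c = a ∨ c = b) := by
  revert a b c; decide

lemma arcTile_type {a b : Side} : a ≠ b →
    arcTile a b ≠ .dot ∧ arcTile a b ≠ .I ∧ ¬ (arcTile a b).IsCrossing ∧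
      ¬ (arcTile a b).IsDouble := by
  revert a b; decide

lemma eq_I_or_eq_arcTile {a b : Side} {t : Tile} : a.Perp b → t ≠ .dot → ¬ t.Meets a →
    ¬ t.Meets b → t = .I ∨ t = arcTile a.opp b.opp := by
  revert a b; cases t <;> decide

/-- Tiles with two arcs meet all four sides, so a missed side leaves a single arc. -/
lemma exists_eq_arcTile {s t : Side} {x : Tile} : s.Perp t → x ≠ .dot → x.Meets t →
    ¬ x.Meets s → ∃ e, e ≠ s ∧ (e = s.opp ∨ e = t.opp) ∧ x = arcTile e t := by
  revert s t x; decide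

lemma meets_addArc {a b c : Side} {t : Tile} : a.Perp b → t ≠ .dot → ¬ t.Meets a →
    ¬ t.Meets b → ((t.addArc a b).Meets c ↔ t.Meets c ∨ c = a ∨ c = b) := by
  revert a b c; cases t <;> decide

lemma addArc_type {a b : Side} {t : Tile} : a.Perp b → t ≠ .dot →
    t.addArc a b ≠ .dot ∧ t.addArc a b ≠ .I ∧ ¬ (t.addArc a b).IsCrossing := by
  revert a b t; decide

lemma meets_Va (c : Side) : Tile.Va.Meets c := by revert c; decide

/-- Duality moves a quarter turn to the opposite corner, and tiles of type IV in the dual replace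
blank tiles only. -/
lemma IsDualTile.not_meets {m d : Tile} {a b : Side} : IsDualTile m d → d.Joins a b → a.Perp b →
    ¬ m.Meets a ∧ ¬ m.Meets b := by
  revert m d a b; decide

lemma not_isCrossing {a b : Side} {t : Tile} : a.Perp b → ¬ t.Meets a →
    ¬ t.Meets b → ¬ t.IsCrossing := by
  revert a b t; decide

lemma chord_comm (p : Pos) (a b : Side) : chord p a b = chord p b a := segment_symm ..

lemma curve_arcTile (p : Pos) {a b : Side} (h : a ≠ b) :
    (arcTile a b).curve p = chord p a b := by
  cases a <;> cases b <;> simp_all [arcTile, Tile.curve] <;> exact chord_comm ..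

lemma curve_addArc (p : Pos) {a b : Side} {t : Tile} (h : a.Perp b) (ht : t ≠ .dot)
    (ha : ¬ t.Meets a) (hb : ¬ t.Meets b) :
    (t.addArc a b).curve p = t.curve p ∪ chord p a b := by
  rcases eq_I_or_eq_arcTile h ht ha hb with rfl | rfl
  · simpa [Tile.addArc, Tile.curve] using curve_arcTile p h.ne
  · revert h
    cases a <;> cases b <;> simp [arcTile, Tile.curve, Tile.addArc, Side.Perp, Side.opp,
      chord_comm _ .bottom .left, chord_comm _ .top .right, chord_comm _ .right .bottom,
      chord_comm _ .left .top, Set.union_comm]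

@[simp] lemma nbr_nbr_opp (p : Pos) (s : Side) : nbr (nbr p s) s.opp = p := by
  cases s <;> simp [nbr, Side.opp]

@[simp] lemma nbr_opp_nbr (p : Pos) (s : Side) : nbr (nbr p s.opp) s = p := by
  cases s <;> simp [nbr, Side.opp]

lemma nbr_comm (p : Pos) (s t : Side) : nbr (nbr p s) t = nbr (nbr p t) s := by
  cases s <;> cases t <;> simp [nbr]

lemma nbr_ne (p : Pos) (s : Side) : nbr p s ≠ p := by
  cases s <;> simp [nbr, Prod.ext_iff]

lemma nbr_injective (p : Pos) : Function.Injective (nbr p) := by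
  intro s t h
  cases s <;> cases t <;> simp [nbr, Prod.ext_iff] at h ⊢ <;> omega

lemma nbr_nbr_ne {s t : Side} (h : s.Perp t) (p : Pos) (a : Side) :
    nbr (nbr p s) t ≠ nbr p a ∧ nbr (nbr p s) t ≠ p := by
  revert h
  cases s <;> cases t <;> cases a <;> simp [nbr, Prod.ext_iff, Side.Perp, Side.opp]

/-! ### The curves of the tiles -/

/-- Projected to the plane, all pieces are convex combinations of side midpoints and the center. The
resulting diamonds of different tiles barely touch and leave square gaps around the corners of the
grid. -/
lemma curve_diamond {p : Pos} {t : Tile} {q : Space} (h : q ∈ t.curve p) :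
    |q.1 - p.2| + |q.2.1 - p.1| ≤ 1 / 2 := by
  have key : ∀ a b : Side, q ∈ chord p a b → |q.1 - p.2| + |q.2.1 - p.1| ≤ 1 / 2 := by
    rintro a b ⟨u, v, hu, hv, huv, rfl⟩
    obtain rfl : v = 1 - u := by linarith
    cases a <;> cases b <;> simp only [mid, Prod.smul_mk, Prod.mk_add_mk, smul_eq_mul] <;>
      apply abs_add_abs_le_of <;> linarith
  have key' : ∀ a b : Side, q ∈ bridge p a b → |q.1 - p.2| + |q.2.1 - p.1| ≤ 1 / 2 := by
    rintro a b (⟨u, v, hu, hv, huv, rfl⟩ | ⟨u, v, hu, hv, huv, rfl⟩) <;>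
    obtain rfl : v = 1 - u := by linarith
    · cases a <;> simp only [mid, center, Prod.smul_mk, Prod.mk_add_mk, smul_eq_mul] <;>
        apply abs_add_abs_le_of <;> linarith
    · cases b <;> simp only [mid, center, Prod.smul_mk, Prod.mk_add_mk, smul_eq_mul] <;>
        apply abs_add_abs_le_of <;> linarith
  cases t <;> simp only [Tile.curve, Set.mem_empty_iff_false, Set.mem_union] at h <;>
    grind

lemma chord_mid {p : Pos} {a b s : Side} {q : Space} (h : q ∈ chord p a b) (hab : a ≠ b)
    (h1 : q.1 = (mid p s).1) (h2 : q.2.1 = (mid p s).2.1) : q = mid p s ∧ (s = a ∨ s = b) := by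
  obtain ⟨u, v, hu, hv, huv, rfl⟩ := h
  obtain rfl : v = 1 - u := by linarith
  cases a <;> cases b <;> cases s <;> simp [mid] at hab h1 h2 ⊢ <;> grind

lemma bridge_mid {p : Pos} {a b s : Side} {q : Space} (h : q ∈ bridge p a b)
    (h1 : q.1 = (mid p s).1) (h2 : q.2.1 = (mid p s).2.1) : q = mid p s := by
  obtain (⟨u, v, hu, hv, huv, rfl⟩ | ⟨u, v, hu, hv, huv, rfl⟩) := h <;>
    obtain rfl : v = 1 - u := by linarith
  · cases a <;> cases s <;> simp [mid, center] at h1 h2 ⊢ <;> grind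
  · cases b <;> cases s <;> simp [mid, center] at h1 h2 ⊢ <;> grind

/-- Over a side midpoint a curve can only be at height 0, so agreement in the projection there is
agreement in space. -/
lemma curve_mid {p : Pos} {t : Tile} {s : Side} {q : Space} (h : q ∈ t.curve p)
    (h1 : q.1 = (mid p s).1) (h2 : q.2.1 = (mid p s).2.1) : q = mid p s ∧ t.Meets s := by
  cases t <;> simp only [Tile.curve, Set.mem_empty_iff_false, Set.mem_union] at h
  case Va => exact ⟨h.elim (bridge_mid · h1 h2) fun h => (chord_mid h (by decide) h1 h2).1,
    meets_Va s⟩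
  case Vb => exact ⟨h.elim (fun h => (chord_mid h (by decide) h1 h2).1) (bridge_mid · h1 h2),
    by clear h1 h2; revert s; decide⟩
  case IVa | IVb =>
    rcases h with h | h <;> obtain ⟨e, rfl | rfl⟩ := chord_mid h (by decide) h1 h2 <;>
      exact ⟨e, by decide⟩
  all_goals
    obtain ⟨e, rfl | rfl⟩ := chord_mid h (by decide) h1 h2 <;> exact ⟨e, by decide⟩

/-- The diamonds that contain the curves of two distinct tiles meet only in the midpoint of a
common side. -/
lemma exists_eq_nbr {p p' : Pos} {q : Space} (h : |q.1 - p.2| + |q.2.1 - p.1| ≤ 1 / 2)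
    (h' : |q.1 - p'.2| + |q.2.1 - p'.1| ≤ 1 / 2) (hne : p' ≠ p) :
    ∃ s, p' = nbr p s ∧ q.1 = (mid p s).1 ∧ q.2.1 = (mid p s).2.1 := by
  obtain ⟨a, b⟩ := p
  obtain ⟨c, d⟩ := p'
  obtain ⟨x, y, z⟩ := q
  dsimp only at h h'
  -- By the triangle inequality the centers have ℓ¹-distance at most 1; integrality then leaves only
  -- the four neighbors.
  have hx : |(d : ℝ) - b| + |(c : ℝ) - a| ≤ 1 := by
    linarith [abs_sub_le (d : ℝ) x b, abs_sub_le (c : ℝ) y a, abs_sub_comm (d : ℝ) x,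
      abs_sub_comm (c : ℝ) y]
  have hz : |d - b| + |c - a| ≤ 1 := by exact_mod_cast hx
  have hc : (c = a ∧ d = b - 1) ∨ (c = a ∧ d = b + 1) ∨ (c = a - 1 ∧ d = b) ∨
      (c = a + 1 ∧ d = b) := by
    rw [Ne, Prod.mk.injEq] at hne
    have := le_abs_self (d - b)
    have := neg_abs_le (d - b)
    have := le_abs_self (c - a)
    have := neg_abs_le (c - a)
    omega
  have := le_abs_self (x - b)
  have := neg_abs_le (x - b)
  have := le_abs_self (y - a)
  have := neg_abs_le (y - a)
  have := le_abs_self (x - d)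
  have := neg_abs_le (x - d)
  have := le_abs_self (y - c)
  have := neg_abs_le (y - c)
  rcases hc with ⟨rfl, rfl⟩ | ⟨rfl, rfl⟩ | ⟨rfl, rfl⟩ | ⟨rfl, rfl⟩
  · refine ⟨.left, rfl, ?_⟩
    push_cast [mid] at *
    constructor <;> linarith
  · refine ⟨.right, rfl, ?_⟩
    push_cast [mid] at *
    constructor <;> linarith
  · refine ⟨.bottom, rfl, ?_⟩
    push_cast [mid] at *
    constructor <;> linarith
  · refine ⟨.top, rfl, ?_⟩
    push_cast [mid] at *
    constructor <;> linarith

lemma mid_nbr_opp (p : Pos) (s : Side) : mid (nbr p s) s.opp = mid p s := by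
  cases s <;> simp [mid, nbr, Side.opp] <;> ring

/-- The rest of the link meets the diamond of a tile only in midpoints of sides of the tile at
which arcs end. -/
lemma Mosaic.IsLinkMosaic.eq_mid {n : ℕ} {M : Mosaic n} (hM : M.IsLinkMosaic) {p p' : Pos}
    (hne : p' ≠ p) {q : Space} (hq : q ∈ (M.tile p').curve p')
    (h : |q.1 - p.2| + |q.2.1 - p.1| ≤ 1 / 2) : ∃ s, (M.tile p).Meets s ∧ q = mid p s := by
  obtain ⟨s, rfl, h1, h2⟩ := exists_eq_nbr h (curve_diamond hq) hne
  rw [← mid_nbr_opp] at h1 h2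
  obtain ⟨e, hm⟩ := curve_mid hq h1 h2
  exact ⟨s, (hM p s).2 hm, by rw [e, mid_nbr_opp]⟩

/-! ### Local coordinates -/

/-- The unit vector that points from the center of a tile to a side. -/
def Side.dir : Side → Space
  | .left => (-1, 0, 0)
  | .right => (1, 0, 0)
  | .bottom => (0, -1, 0)
  | .top => (0, 1, 0)

/-- The coordinates with origin at the center of the tile at `p` whose first two axes point to the
sides `s` and `t`. -/
noncomputable def frame (p : Pos) (s t : Side) : Space →ᵃ[ℝ] Space where
  toFun x := x.1 • s.dir + x.2.1 • t.dir + center p x.2.2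
  linear :=
    { toFun := fun x => x.1 • s.dir + x.2.1 • t.dir + (0, 0, x.2.2)
      map_add' := fun x y => by
        ext <;> simp <;> ring
      map_smul' := fun c x => by
        ext <;> simp <;> ring }
  map_vadd' x y := by
    ext <;> simp [center] <;> ring

lemma frame_apply (p : Pos) (s t : Side) (x : Space) :
    frame p s t x = x.1 • s.dir + x.2.1 • t.dir + center p x.2.2 := rfl

lemma frame_bijective (p : Pos) {s t : Side} (h : s.Perp t) :
    Function.Bijective (frame p s t) := by
  constructor
  · rintro ⟨x, y, z⟩ ⟨x', y', z'⟩ e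
    revert h
    cases s <;> cases t <;> simp [frame_apply, Side.dir, center, Side.Perp, Side.opp] at * <;>
      grind
  · intro q
    -- The two directions are orthonormal, so the coordinates are inner products with them.
    refine ⟨((q.1 - p.2) * s.dir.1 + (q.2.1 - p.1) * s.dir.2.1,
      (q.1 - p.2) * t.dir.1 + (q.2.1 - p.1) * t.dir.2.1, q.2.2), ?_⟩
    revert h
    cases s <;> cases t <;> simp [frame_apply, Side.dir, center, Side.Perp, Side.opp]

lemma frame_center (p : Pos) (s t : Side) (z : ℝ) : frame p s t (0, 0, z) = center p z := by
  simp [frame_apply]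

lemma frame_mid (p : Pos) (s t : Side) :
    frame p s t (1 / 2, 0, 0) = mid p s ∧ frame p s t (-1 / 2, 0, 0) = mid p s.opp ∧
      frame p s t (0, 1 / 2, 0) = mid p t ∧ frame p s t (0, -1 / 2, 0) = mid p t.opp := by
  refine ⟨?_, ?_, ?_, ?_⟩
  · cases s <;> simp [frame_apply, Side.dir, center, mid] <;> ring
  · cases s <;> simp [frame_apply, Side.dir, center, mid, Side.opp] <;> ring
  · cases t <;> simp [frame_apply, Side.dir, center, mid] <;> ring
  · cases t <;> simp [frame_apply, Side.dir, center, mid, Side.opp] <;> ring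

/-- Passing to the neighboring tile reflects the frame in the common side and maps the gap to
itself. Statements about one tile at a gap thus carry over to the other three. -/
lemma frame_nbr_left (p : Pos) (s t : Side) (x : Space) :
    frame (nbr p s) s.opp t x = frame p s t (1 - x.1, x.2.1, x.2.2) := by
  cases s <;> cases t <;> ext <;> simp [frame_apply, Side.dir, center, nbr, Side.opp] <;> ring

lemma frame_nbr_right (p : Pos) (s t : Side) (x : Space) :
    frame (nbr p t) s t.opp x = frame p s t (x.1, 1 - x.2.1, x.2.2) := by
  cases s <;> cases t <;> ext <;> simp [frame_apply, Side.dir, center, nbr, Side.opp] <;> ring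

lemma frame_diamond (p : Pos) {s t : Side} (h : s.Perp t) (x : Space) :
    |(frame p s t x).1 - p.2| + |(frame p s t x).2.1 - p.1| = |x.1| + |x.2.1| := by
  revert h
  cases s <;> cases t <;> simp [frame_apply, Side.dir, center, Side.Perp, Side.opp, add_comm]

/-- A curve in a tile that does not end on the sides `s` and `t` does not reach the gap between the
diamonds of the four tiles around the common corner of `s` and `t`. -/
lemma not_mem_curve_of_gap {p : Pos} {s t : Side} {x : Tile} (h : s.Perp t) (hx : x ≠ .dot)
    (hs : ¬ x.Meets s) (ht : ¬ x.Meets t) {w : Space}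
    (hw : |w.1 - 1 / 2| + |w.2.1 - 1 / 2| ≤ 1 / 2) : frame p s t w ∉ x.curve p := by
  intro hq
  rcases eq_I_or_eq_arcTile h hx hs ht with rfl | rfl
  · exact hq
  -- The only possible arc cuts off the far corner. Its coordinates are both nonpositive, hence too
  -- far from the center `(1/2, 1/2)` of the gap.
  · rw [curve_arcTile _ (by exact h.symm.opp_left.symm.opp_left.ne), chord,
      ← (frame_mid p s t).2.1, ← (frame_mid p s t).2.2.2, ← image_segment] at hq
    obtain ⟨w', ⟨u, v, hu, hv, huv, rfl⟩, e⟩ := hq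
    obtain rfl := (frame_bijective p h).1 e
    simp at hw
    have := neg_abs_le (u * (-1 / 2) - 2⁻¹)
    have := neg_abs_le (v * (-1 / 2) - 2⁻¹)
    linarith

/-- Only four tiles can reach the gap between their diamonds. -/
lemma eq_of_mem_gap {p p' : Pos} {s t : Side} {x : Tile} (h : s.Perp t) {w : Space}
    (hw : |w.1 - 1 / 2| + |w.2.1 - 1 / 2| ≤ 1 / 2) (hq : frame p s t w ∈ x.curve p') :
    p' = p ∨ p' = nbr p s ∨ p' = nbr p t ∨ p' = nbr (nbr p s) t := by
  -- Both coordinates in the gap lie between 0 and 1, so a tile center within 1/2 in one direction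
  -- has only two possible integer values there. The two implications are for axes that point in the
  -- positive and the negative direction.
  have key : ∀ {u v : ℤ} {x y : ℝ}, |y - v| ≤ 1 / 2 → |x - 1 / 2| ≤ 1 / 2 →
      (y = u + x → v = u ∨ v = u + 1) ∧ (y = -x + u → v = u ∨ v = u - 1) := by
    intro u v x y h1 h2
    rw [abs_le] at h1 h2
    constructor <;> rintro rfl
    · have h3 : (v : ℝ) - u < 2 := by linarith
      have h4 : (u : ℝ) - v < 1 := by linarith
      norm_cast at h3 h4
      omega
    · have h3 : (u : ℝ) - v < 2 := by linarith
      have h4 : (v : ℝ) - u < 1 := by linarith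
      norm_cast at h3 h4
      omega
  have hd := curve_diamond hq
  obtain ⟨a, b⟩ := p
  obtain ⟨c, d⟩ := p'
  obtain ⟨x, y, z⟩ := w
  have hx : |x - 1 / 2| ≤ 1 / 2 := by linarith [abs_nonneg (y - 1 / 2)]
  have hy : |y - 1 / 2| ≤ 1 / 2 := by linarith [abs_nonneg (x - 1 / 2)]
  have h1 := (le_add_of_nonneg_right (abs_nonneg _)).trans hd
  have h2 := (le_add_of_nonneg_left (abs_nonneg _)).trans hd
  have h1x := key (u := b) h1 hx
  have h1y := key (u := b) h1 hy
  have h2x := key (u := a) h2 hx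
  have h2y := key (u := a) h2 hy
  revert h
  cases s <;> cases t <;> simp [frame_apply, Side.dir, center, Side.Perp, Side.opp, nbr] at * <;>
    grind

/-! ### Changing the four tiles around a corner -/

/-- The tile `x'` meets the same sides as `x`, except for `a` and `b`, each of which is met by exactly
one of `x` and `x'`. -/
def Tile.Toggle (a b : Side) (x x' : Tile) : Prop :=
  ∀ c, x'.Meets c ↔ (x.Meets c ↔ ¬ (c = a ∨ c = b))

/-- The mosaic `M'` arises from `M` by changing the four tiles around the common corner of the sides
`s` and `t` of the tile at `p`. -/
structure IsRetiling {n : ℕ} (M M' : Mosaic n) (p : Pos) (s t : Side) (x₁ x₂ x₃ x₄ : Tile) :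
    Prop where
  tile₁ : M'.tile p = x₁
  tile₂ : M'.tile (nbr p s) = x₂
  tile₃ : M'.tile (nbr p t) = x₃
  tile₄ : M'.tile (nbr (nbr p s) t) = x₄
  tile_eq : ∀ q, q ≠ p → q ≠ nbr p s → q ≠ nbr p t → q ≠ nbr (nbr p s) t →
    M'.tile q = M.tile q

lemma exists_isRetiling {n : ℕ} (M : Mosaic n) {p : Pos} {s t : Side} (h : s.Perp t)
    {x₁ x₂ x₃ x₄ : Tile} (h₁ : x₁ ≠ .dot) (h₂ : x₂ ≠ .dot) (h₃ : x₃ ≠ .dot) (h₄ : x₄ ≠ .dot)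
    (b₁ : p ∈ board n) (b₂ : nbr p s ∈ board n) (b₃ : nbr p t ∈ board n)
    (b₄ : nbr (nbr p s) t ∈ board n) : ∃ M' : Mosaic n, IsRetiling M M' p s t x₁ x₂ x₃ x₄ := by
  refine ⟨⟨fun q => if q = p then x₁ else if q = nbr p s then x₂ else if q = nbr p t then x₃
    else if q = nbr (nbr p s) t then x₄ else M.tile q, ?_, ?_⟩, ?_⟩
  · intro q
    have := M.ne_dot q
    split_ifs <;> assumption
  · intro q hq
    have := M.blank_outside q hq
    split_ifs <;> simp_all
  · have e₁ := nbr_ne p s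
    have e₂ := nbr_ne p t
    have e₃ := nbr_nbr_ne h p s
    have e₄ := nbr_nbr_ne h p t
    have e₅ := (nbr_injective p).ne h.ne.symm
    constructor <;> simp_all

/-- Each of the four sides at the corner belongs to two of the four tiles. Both tiles toggle it, so
they still agree. -/
lemma IsRetiling.isLinkMosaic {n : ℕ} {M M' : Mosaic n} {p : Pos} {s t : Side}
    {x₁ x₂ x₃ x₄ : Tile} (h : IsRetiling M M' p s t x₁ x₂ x₃ x₄) (hM : M.IsLinkMosaic)
    (hst : s.Perp t)
    (h₁ : Tile.Toggle s t (M.tile p) x₁) (h₂ : Tile.Toggle s.opp t (M.tile (nbr p s)) x₂)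
    (h₃ : Tile.Toggle s t.opp (M.tile (nbr p t)) x₃)
    (h₄ : Tile.Toggle s.opp t.opp (M.tile (nbr (nbr p s) t)) x₄) : M'.IsLinkMosaic := by
  -- The eight toggled pairs of a tile and a side; this set is invariant under passing through the
  -- side.
  let E : Pos → Side → Prop := fun q a => (q = p ∧ (a = s ∨ a = t)) ∨
    (q = nbr p s ∧ (a = s.opp ∨ a = t)) ∨ (q = nbr p t ∧ (a = s ∨ a = t.opp)) ∨
    (q = nbr (nbr p s) t ∧ (a = s.opp ∨ a = t.opp))
  have hE : ∀ q a, E q a → E (nbr q a) a.opp := by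
    rintro q a (⟨rfl, rfl | rfl⟩ | ⟨rfl, rfl | rfl⟩ | ⟨rfl, rfl | rfl⟩ | ⟨rfl, rfl | rfl⟩)
    · simp [E]
    · simp [E]
    · simp [E]
    · simp [E]
    · simp [E, nbr_comm _ t a]
    · simp [E]
    · simp [E, nbr_comm _ s t]
    · simp [E]
  have hE' : ∀ q a, E q a ↔ E (nbr q a) a.opp := fun q a =>
    ⟨hE q a, fun h => by simpa using hE _ _ h⟩
  have e₁ := nbr_ne p s
  have e₂ := nbr_ne p t
  have e₃ := nbr_nbr_ne hst p s
  have e₄ := nbr_nbr_ne hst p t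
  have e₅ := (nbr_injective p).ne hst.ne.symm
  have key : ∀ q a, (M'.tile q).Meets a ↔ ((M.tile q).Meets a ↔ ¬ E q a) := by
    intro q a
    by_cases c₁ : q = p
    · subst c₁
      rw [h.tile₁, h₁ a]
      simp [E, e₁.symm, e₂.symm, e₃.2.symm]
    by_cases c₂ : q = nbr p s
    · subst c₂
      rw [h.tile₂, h₂ a]
      simp [E, e₁, e₅.symm, e₃.1.symm]
    by_cases c₃ : q = nbr p t
    · subst c₃
      rw [h.tile₃, h₃ a]
      simp [E, e₂, e₅, e₄.1.symm]
    by_cases c₄ : q = nbr (nbr p s) t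
    · subst c₄
      rw [h.tile₄, h₄ a]
      simp [E, e₃.1, e₃.2, e₄.1]
    rw [h.tile_eq q c₁ c₂ c₃ c₄]
    simp [E, c₁, c₂, c₃, c₄]
  intro q a
  rw [key, key, hM q a, hE' q a]

lemma IsRetiling.mem_link_iff {n : ℕ} {M M' : Mosaic n} {p : Pos} {s t : Side}
    {x₁ x₂ x₃ x₄ : Tile} (h : IsRetiling M M' p s t x₁ x₂ x₃ x₄) (w : Space) :
    w ∈ M'.link ↔ (∃ q, q ≠ p ∧ q ≠ nbr p s ∧ q ≠ nbr p t ∧ q ≠ nbr (nbr p s) t ∧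
      w ∈ (M.tile q).curve q) ∨ w ∈ x₁.curve p ∨ w ∈ x₂.curve (nbr p s) ∨
      w ∈ x₃.curve (nbr p t) ∨ w ∈ x₄.curve (nbr (nbr p s) t) := by
  simp only [Mosaic.link, Set.mem_iUnion]
  constructor
  · rintro ⟨q, hq⟩
    by_cases c₁ : q = p
    · subst c₁
      rw [h.tile₁] at hq
      tauto
    by_cases c₂ : q = nbr p s
    · subst c₂
      rw [h.tile₂] at hq
      tauto
    by_cases c₃ : q = nbr p t
    · subst c₃
      rw [h.tile₃] at hq
      tauto
    by_cases c₄ : q = nbr (nbr p s) t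
    · subst c₄
      rw [h.tile₄] at hq
      tauto
    rw [h.tile_eq q c₁ c₂ c₃ c₄] at hq
    exact Or.inl ⟨q, c₁, c₂, c₃, c₄, hq⟩
  · rintro (⟨q, c₁, c₂, c₃, c₄, hq⟩ | hq | hq | hq | hq)
    · exact ⟨q, by rwa [h.tile_eq q c₁ c₂ c₃ c₄]⟩
    · exact ⟨p, by rwa [h.tile₁]⟩
    · exact ⟨nbr p s, by rwa [h.tile₂]⟩
    · exact ⟨nbr p t, by rwa [h.tile₃]⟩
    · exact ⟨nbr (nbr p s) t, by rwa [h.tile₄]⟩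

lemma IsRetiling.forall_tile {n : ℕ} {M M' : Mosaic n} {p : Pos} {s t : Side}
    {x₁ x₂ x₃ x₄ : Tile} (h : IsRetiling M M' p s t x₁ x₂ x₃ x₄) {P : Tile → Tile → Prop}
    (h₀ : ∀ x, P x x) (h₁ : P (M.tile p) x₁) (h₂ : P (M.tile (nbr p s)) x₂)
    (h₃ : P (M.tile (nbr p t)) x₃) (h₄ : P (M.tile (nbr (nbr p s) t)) x₄) (q : Pos) :
    P (M.tile q) (M'.tile q) := by
  by_cases c₁ : q = p
  · rwa [c₁, h.tile₁]
  by_cases c₂ : q = nbr p s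
  · rwa [c₂, h.tile₂]
  by_cases c₃ : q = nbr p t
  · rwa [c₃, h.tile₃]
  by_cases c₄ : q = nbr (nbr p s) t
  · rwa [c₄, h.tile₄]
  rw [h.tile_eq q c₁ c₂ c₃ c₄]
  exact h₀ _

lemma Mosaic.mem_link_iff {n : ℕ} (M : Mosaic n) (p : Pos) (s t : Side) (w : Space) :
    w ∈ M.link ↔ (∃ q, q ≠ p ∧ q ≠ nbr p s ∧ q ≠ nbr p t ∧ q ≠ nbr (nbr p s) t ∧
      w ∈ (M.tile q).curve q) ∨ w ∈ (M.tile p).curve p ∨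
      w ∈ (M.tile (nbr p s)).curve (nbr p s) ∨ w ∈ (M.tile (nbr p t)).curve (nbr p t) ∨
      w ∈ (M.tile (nbr (nbr p s) t)).curve (nbr (nbr p s) t) :=
  IsRetiling.mem_link_iff ⟨rfl, rfl, rfl, rfl, fun _ _ _ _ _ => rfl⟩ w

/-! ### The gap between four tiles -/

lemma abs_one_sub_sub_half (x : ℝ) : |1 - x - 1 / 2| = |x - 1 / 2| := by
  rw [abs_sub_comm x]
  congr 1
  ring

lemma not_mem_curve_nbr_left {p : Pos} {s t : Side} {x : Tile} (h : s.Perp t) (hx : x ≠ .dot)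
    (hs : ¬ x.Meets s.opp) (ht : ¬ x.Meets t) {w : Space}
    (hw : |w.1 - 1 / 2| + |w.2.1 - 1 / 2| ≤ 1 / 2) : frame p s t w ∉ x.curve (nbr p s) := by
  have := not_mem_curve_of_gap (p := nbr p s) h.opp_left hx hs ht (w := (1 - w.1, w.2))
    (by simpa only [abs_one_sub_sub_half] using hw)
  rw [frame_nbr_left] at this
  simpa using this

lemma not_mem_curve_nbr_right {p : Pos} {s t : Side} {x : Tile} (h : s.Perp t) (hx : x ≠ .dot)
    (hs : ¬ x.Meets s) (ht : ¬ x.Meets t.opp) {w : Space}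
    (hw : |w.1 - 1 / 2| + |w.2.1 - 1 / 2| ≤ 1 / 2) : frame p s t w ∉ x.curve (nbr p t) := by
  have := not_mem_curve_of_gap (p := nbr p t) h.opp_right hx hs ht
    (w := (w.1, 1 - w.2.1, w.2.2)) (by simpa only [abs_one_sub_sub_half] using hw)
  rw [frame_nbr_right] at this
  simpa using this

lemma not_mem_curve_nbr_nbr {p : Pos} {s t : Side} {x : Tile} (h : s.Perp t) (hx : x ≠ .dot)
    (hs : ¬ x.Meets s.opp) (ht : ¬ x.Meets t.opp) {w : Space}
    (hw : |w.1 - 1 / 2| + |w.2.1 - 1 / 2| ≤ 1 / 2) :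
    frame p s t w ∉ x.curve (nbr (nbr p s) t) := by
  have := not_mem_curve_nbr_right (p := nbr p s) h.opp_left hx hs ht (w := (1 - w.1, w.2))
    (by simpa only [abs_one_sub_sub_half] using hw)
  rw [frame_nbr_left] at this
  simpa using this

lemma frame_mid_nbr (p : Pos) (s t : Side) :
    frame p s t (1, 1 / 2, 0) = mid (nbr p s) t ∧ frame p s t (1 / 2, 1, 0) = mid (nbr p t) s ∧
      frame p s t (-1 / 2, 1, 0) = mid (nbr p t) s.opp ∧
      frame p s t (0, 3 / 2, 0) = mid (nbr p t) t := by
  have h1 := (frame_mid (nbr p s) s.opp t).2.2.1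
  have h2 := (frame_mid (nbr p t) s t.opp).1
  have h3 := (frame_mid (nbr p t) s t.opp).2.1
  have h4 := (frame_mid (nbr p t) s t.opp).2.2.2
  rw [frame_nbr_left] at h1
  rw [frame_nbr_right] at h2 h3 h4
  norm_num at h1 h2 h3 h4 ⊢
  exact ⟨h1, h2, h3, h4⟩

lemma mid_nbr_nbr (p : Pos) (s t : Side) :
    mid (nbr (nbr p s) t) t.opp = mid (nbr p s) t ∧
      mid (nbr (nbr p s) t) s.opp = mid (nbr p t) s :=
  ⟨mid_nbr_opp _ _, by rw [nbr_comm, mid_nbr_opp]⟩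

/-- The condition on `s` puts the over-strand along the first axis of the frame, to match
`isotopic_kink`. -/
lemma curve_Va (p : Pos) {s t : Side} (hs : s = .left ∨ s = .right) (h : s.Perp t) :
    Tile.Va.curve p = bridge p s.opp s ∪ chord p t t.opp := by
  have : bridge p .right .left = bridge p .left .right := by
    rw [bridge, bridge, Set.union_comm, segment_symm ℝ (center p 1) (mid p .left),
      segment_symm ℝ (mid p .right)]
  revert h
  rcases hs with rfl | rfl <;> cases t <;>
    simp [Side.Perp, Side.opp, Tile.curve, this, chord_comm p .top]

/-! ### Duals and triples -/

lemma exists_isDual {n : ℕ} (M : Mosaic n) : ∃ D : InteriorTiling n, IsDual M D := by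
  have h : ∀ p : interior n, ∃ d, IsDualTile (M.tile p) d := by
    intro p
    have := M.ne_dot p
    revert this
    generalize M.tile p = x
    revert x
    decide
  choose D hD using h
  exact ⟨D, hD⟩

/-- Reads the three counts of the triple off the mosaic itself; in particular they do not depend on
the choice of the dual. -/
lemma IsDualTile.iff {m d : Tile} : IsDualTile m d → (d ≠ .I ↔ ¬ m.IsCrossing) ∧
    (d ≠ .I ∧ d ≠ .dot ↔ ¬ m.IsCrossing ∧ ¬ m.IsDouble) ∧ (d = .IVa ∨ d = .IVb ↔ m = .I) := by
  revert m d; decide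

/-- The mosaic `M'` has smaller triples than `M`. -/
def Mosaic.Smaller {n : ℕ} (M' M : Mosaic n) : Prop :=
  ∀ D' D : InteriorTiling n, IsDual M' D' → IsDual M D → triple D' < triple D

/-- A gained crossing lowers the first entry `l`, whatever happens to the other two. -/
lemma smaller_of_crossing {n : ℕ} {M M' : Mosaic n}
    (h : ∀ q, (M.tile q).IsCrossing → (M'.tile q).IsCrossing) {p : Pos} (hp : p ∈ interior n)
    (h' : (M'.tile p).IsCrossing) (h'' : ¬ (M.tile p).IsCrossing) : M'.Smaller M := by
  intro D' D hD' hD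
  refine Prod.Lex.toLex_lt_toLex.2 (Or.inl (Finset.card_lt_card ?_))
  rw [Finset.ssubset_iff_of_subset]
  · refine ⟨⟨p, hp⟩, ?_, ?_⟩ <;> rw [Finset.mem_filter]
    · exact ⟨Finset.mem_univ _, (hD _).iff.1.2 h''⟩
    · exact fun h => (hD' _).iff.1.1 h.2 h'
  · intro q hq
    rw [Finset.mem_filter] at hq ⊢
    exact ⟨hq.1, (hD q).iff.1.2 fun hc => (hD' q).iff.1.1 hq.2 (h _ hc)⟩

/-- The entries `l` and `l'` agree, and `l''` loses the tile at `p`. -/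
lemma smaller_of_blank {n : ℕ} {M M' : Mosaic n}
    (h : ∀ q, ((M'.tile q).IsCrossing ↔ (M.tile q).IsCrossing) ∧
      ((M'.tile q).IsDouble ↔ (M.tile q).IsDouble) ∧ (M'.tile q = .I → M.tile q = .I))
    {p : Pos} (hp : p ∈ interior n) (h' : M.tile p = .I) (h'' : M'.tile p ≠ .I) :
    M'.Smaller M := by
  intro D' D hD' hD
  refine Prod.Lex.toLex_lt_toLex.2 (Or.inr ⟨?_, Prod.Lex.toLex_lt_toLex.2 (Or.inr ⟨?_, ?_⟩)⟩)
  · refine congrArg Finset.card (Finset.filter_congr fun q _ => ?_)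
    rw [(hD q).iff.1, (hD' q).iff.1, (h q).1]
  · refine congrArg Finset.card (Finset.filter_congr fun q _ => ?_)
    rw [(hD q).iff.2.1, (hD' q).iff.2.1, (h q).1, (h q).2.1]
  · refine Finset.card_lt_card ?_
    rw [Finset.ssubset_iff_of_subset]
    · refine ⟨⟨p, hp⟩, ?_, ?_⟩ <;> rw [Finset.mem_filter]
      · exact ⟨Finset.mem_univ _, (hD _).iff.2.2.2 h'⟩
      · exact fun h => h'' ((hD' _).iff.2.2.1 h.2)
    · intro q hq
      rw [Finset.mem_filter] at hq ⊢
      exact ⟨hq.1, (hD q).iff.2.2.2 ((h q).2.2 ((hD' q).iff.2.2.1 hq.2))⟩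

/-- Some mosaic with an equivalent link has smaller triples. -/
def Mosaic.Improvable {n : ℕ} (M : Mosaic n) : Prop :=
  ∃ M' : Mosaic n, M'.IsLinkMosaic ∧ Isotopic M.link M'.link ∧ M'.Smaller M

lemma interior_subset_board (n : ℕ) : interior n ⊆ board n := by
  intro p hp
  simp only [interior, board, Finset.mem_product, Finset.mem_Icc] at *
  omega

/-! ### Improving a mosaic -/

/-- If four interior tiles do not meet the sides at their common corner and one of them has an arc,
then a kink can be added to that arc. -/
lemma improvable_of_kink {n : ℕ} {M : Mosaic n} (hM : M.IsLinkMosaic) {p : Pos} {s t : Side}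
    (hst : s.Perp t) (hs : s = .left ∨ s = .right)
    (i₁ : p ∈ interior n) (i₂ : nbr p s ∈ interior n) (i₃ : nbr p t ∈ interior n)
    (i₄ : nbr (nbr p s) t ∈ interior n)
    (m₁ : ¬ (M.tile p).Meets s) (m₂ : ¬ (M.tile p).Meets t)
    (m₃ : ¬ (M.tile (nbr p s)).Meets t) (m₄ : ¬ (M.tile (nbr p t)).Meets s)
    (hp : M.tile p ≠ .I) : M.Improvable := by
  have m₅ : ¬ (M.tile (nbr p s)).Meets s.opp := fun h => m₁ ((hM p s).2 h)
  have m₆ : ¬ (M.tile (nbr p t)).Meets t.opp := fun h => m₂ ((hM p t).2 h)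
  have m₇ : ¬ (M.tile (nbr (nbr p s) t)).Meets t.opp := fun h => m₃ ((hM _ t).2 h)
  have m₈ : ¬ (M.tile (nbr (nbr p s) t)).Meets s.opp := fun h => m₄ ((hM _ s).2
    (by rwa [nbr_comm]))
  have e₁ := (eq_I_or_eq_arcTile hst (M.ne_dot p) m₁ m₂).resolve_left hp
  have hso := hst.opp_left
  have hto := hst.opp_right
  have hsto := hso.opp_right
  obtain ⟨M', h⟩ := exists_isRetiling M hst (x₁ := .Va) (by decide)
    (addArc_type hso (M.ne_dot (nbr p s))).1 (addArc_type hto (M.ne_dot (nbr p t))).1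
    (addArc_type hsto.symm (M.ne_dot (nbr (nbr p s) t))).1 (interior_subset_board n i₁)
    (interior_subset_board n i₂) (interior_subset_board n i₃) (interior_subset_board n i₄)
  refine ⟨M', h.isLinkMosaic hM hst ?_ ?_ ?_ ?_, ?_, smaller_of_crossing (p := p) ?_ i₁ ?_
    (not_isCrossing hst m₁ m₂)⟩
  · intro c
    rw [e₁, meets_arcTile hsto.ne]
    have := meets_Va c
    revert hst
    clear * - this
    revert this
    revert s t c
    decide
  · intro c
    rw [meets_addArc hso (M.ne_dot _) m₅ m₃]
    grind
  · intro c
    rw [meets_addArc hto (M.ne_dot _) m₄ m₆]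
    grind
  · intro c
    rw [meets_addArc hsto.symm (M.ne_dot _) m₇ m₈]
    grind
  · obtain ⟨hinj, hsurj⟩ := frame_bijective p hst
    let f := frame p s t
    -- Only the arc at `p` moves; opposite arcs already present in the other three tiles belong to
    -- the fixed part `R`.
    let R : Set Space := {w | ∃ q, q ≠ p ∧ w ∈ (M.tile q).curve q}
    have hR : f '' (f ⁻¹' R) = R := Set.image_preimage_eq _ hsurj
    have hiso := (isotopic_kink (R := f ⁻¹' R) ?_ ?_).image f hinj
    · obtain ⟨f₁, f₂, f₃, f₄⟩ := frame_mid p s t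
      obtain ⟨f₅, f₆, -, -⟩ := frame_mid_nbr p s t
      simp only [Set.image_union, hR, image_segment, f, f₁, f₂, f₃, f₄, f₅, f₆,
        frame_center] at hiso
      have hl : M.link = R ∪ segment ℝ (mid p s.opp) (mid p t.opp) := by
        ext w
        have : (M.tile p).curve p = segment ℝ (mid p s.opp) (mid p t.opp) := by
          rw [e₁, curve_arcTile p hsto.ne, chord]
        rw [← this, Mosaic.link, Set.mem_iUnion]
        constructor
        · rintro ⟨q, hq⟩
          by_cases hqp : q = p
          · exact Or.inr (hqp ▸ hq)
          · exact Or.inl ⟨q, hqp, hq⟩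
        · rintro (⟨q, -, hq⟩ | hq)
          · exact ⟨q, hq⟩
          · exact ⟨p, hq⟩
      rw [hl]
      convert hiso using 1
      ext w
      have hRw : w ∈ R ↔ (∃ q, q ≠ p ∧ q ≠ nbr p s ∧ q ≠ nbr p t ∧ q ≠ nbr (nbr p s) t ∧
          w ∈ (M.tile q).curve q) ∨ w ∈ (M.tile (nbr p s)).curve (nbr p s) ∨
          w ∈ (M.tile (nbr p t)).curve (nbr p t) ∨
          w ∈ (M.tile (nbr (nbr p s) t)).curve (nbr (nbr p s) t) := by
        constructor
        · rintro ⟨q, hqp, hq⟩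
          by_cases c₂ : q = nbr p s
          · subst c₂
            tauto
          by_cases c₃ : q = nbr p t
          · subst c₃
            tauto
          by_cases c₄ : q = nbr (nbr p s) t
          · subst c₄
            tauto
          exact Or.inl ⟨q, hqp, c₂, c₃, c₄, hq⟩
        · rintro (⟨q, hqp, -, -, -, hq⟩ | hq | hq | hq)
          · exact ⟨q, hqp, hq⟩
          · exact ⟨_, nbr_ne p s, hq⟩
          · exact ⟨_, nbr_ne p t, hq⟩
          · exact ⟨_, (nbr_nbr_ne hst p s).2, hq⟩
      rw [h.mem_link_iff, curve_Va p hs hst, curve_addArc _ hso (M.ne_dot _) m₅ m₃,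
        curve_addArc _ hto (M.ne_dot _) m₄ m₆, curve_addArc _ hsto.symm (M.ne_dot _) m₇ m₈]
      simp only [bridge, chord, mid_nbr_opp, mid_nbr_nbr, Set.mem_union, hRw]
      exact Iff.of_eq (by ac_rfl)
    · rintro w ⟨q, hqp, hq⟩ hw
      obtain ⟨a, ha, e⟩ := hM.eq_mid hqp hq ((frame_diamond p hst w).trans_le hw)
      rw [e₁, meets_arcTile hsto.ne] at ha
      rcases ha with rfl | rfl
      · exact Or.inl (hinj (e.trans (frame_mid p s t).2.1.symm))
      · exact Or.inr (hinj (e.trans (frame_mid p s t).2.2.2.symm))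
    · rintro w ⟨q, hqp, hq⟩ hw
      rcases eq_of_mem_gap hst hw hq with rfl | rfl | rfl | rfl
      · exact hqp rfl
      · exact not_mem_curve_nbr_left hst (M.ne_dot _) m₅ m₃ hw hq
      · exact not_mem_curve_nbr_right hst (M.ne_dot _) m₄ m₆ hw hq
      · exact not_mem_curve_nbr_nbr hst (M.ne_dot _) m₈ m₇ hw hq
  · refine h.forall_tile (P := fun x x' => x.IsCrossing → x'.IsCrossing) (fun _ => id)
      (fun _ => Or.inl rfl) (fun hc => absurd hc (not_isCrossing hso m₅ m₃))
      (fun hc => absurd hc (not_isCrossing hto m₄ m₆))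
      (fun hc => absurd hc (not_isCrossing hsto m₈ m₇))
  · rw [h.tile₁]
    exact Or.inl rfl

lemma toggle_arcTile {a b e : Side} (h₁ : e ≠ a) (h₂ : e ≠ b) (h₃ : a ≠ b) :
    Tile.Toggle a b (arcTile e b) (arcTile e a) := by
  intro c
  rw [meets_arcTile h₁, meets_arcTile h₂]
  grind

lemma toggle_I {a b : Side} (h : a ≠ b) : Tile.Toggle a b .I (arcTile a b) := by
  intro c
  have := not_meets_I c
  rw [meets_arcTile h]
  tauto

lemma similar_arcTile {a b : Side} {x : Tile} (hx : ¬ x.IsCrossing ∧ ¬ x.IsDouble) (h : a ≠ b) :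
    ((arcTile a b).IsCrossing ↔ x.IsCrossing) ∧ ((arcTile a b).IsDouble ↔ x.IsDouble) ∧
      (arcTile a b = .I → x = .I) :=
  have ht := arcTile_type h
  ⟨iff_of_false ht.2.2.1 hx.1, iff_of_false ht.2.2.2 hx.2, fun e => absurd e ht.2.1⟩

/-- If a strand passes two adjacent interior blank tiles, it can be pushed into these tiles. -/
lemma improvable_of_push {n : ℕ} {M : Mosaic n} (hM : M.IsLinkMosaic) {p : Pos} {s t : Side}
    (hst : s.Perp t) (i₂ : nbr p s ∈ interior n) (i₄ : nbr (nbr p s) t ∈ interior n)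
    (b₂ : M.tile (nbr p s) = .I) (b₄ : M.tile (nbr (nbr p s) t) = .I)
    (hp : (M.tile p).Meets t) : M.Improvable := by
  have m₁ : ¬ (M.tile p).Meets s := fun h => not_meets_I s.opp (b₂ ▸ (hM p s).1 h)
  have m₃ : ¬ (M.tile (nbr p t)).Meets s := fun h => not_meets_I s.opp
    (b₄ ▸ nbr_comm p s t ▸ (hM _ s).1 h)
  have hp' := (hM p t).1 hp
  have hso := hst.opp_left
  have hto := hst.opp_right
  have hsto := hso.opp_right
  obtain ⟨e, he, het, ep⟩ := exists_eq_arcTile hst (M.ne_dot p) hp m₁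
  obtain ⟨e', he', het', ep'⟩ := exists_eq_arcTile hto (M.ne_dot (nbr p t)) hp' m₃
  rw [Side.opp_opp] at het'
  have hne : ∀ a : Side, a ≠ a.opp := by decide
  have het₁ : e ≠ t := by
    rcases het with rfl | rfl
    · exact hso.ne
    · exact (hne t).symm
  have het₁' : e' ≠ t.opp := by
    rcases het' with rfl | rfl
    · exact hsto.ne
    · exact hne _
  -- Only the blank tiles are assumed to be interior. The strand itself may run along the boundary,
  -- and its tiles are on the board because they are not blank.
  have hboard : ∀ q, M.tile q ≠ .I → q ∈ board n := fun q hq => by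
    by_contra h
    exact hq (M.blank_outside q h)
  obtain ⟨M', h⟩ := exists_isRetiling M hst (x₁ := arcTile e s) (x₂ := arcTile s.opp t)
    (x₃ := arcTile e' s) (x₄ := arcTile s.opp t.opp) (arcTile_type he).1 (arcTile_type hso.ne).1
    (arcTile_type he').1 (arcTile_type hsto.ne).1 (hboard _ (by
      rw [ep]
      exact (arcTile_type het₁).2.1)) (interior_subset_board n i₂) (hboard _ (by
      rw [ep']
      exact (arcTile_type het₁').2.1)) (interior_subset_board n i₄)
  refine ⟨M', h.isLinkMosaic hM hst ?_ ?_ ?_ ?_, ?_,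
    smaller_of_blank (p := nbr p s) ?_ i₂ b₂ ?_⟩
  · rw [ep]
    exact toggle_arcTile he het₁ hst.ne
  · rw [b₂]
    exact toggle_I hso.ne
  · rw [ep']
    exact toggle_arcTile he' het₁' hto.ne
  · rw [b₄]
    exact toggle_I hsto.ne
  · obtain ⟨hinj, hsurj⟩ := frame_bijective p hst
    let f := frame p s t
    let R : Set Space := {w | ∃ q, q ≠ p ∧ q ≠ nbr p s ∧ q ≠ nbr p t ∧ q ≠ nbr (nbr p s) t ∧
      w ∈ (M.tile q).curve q}
    have hR : f '' (f ⁻¹' R) = R := Set.image_preimage_eq _ hsurj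
    obtain ⟨f₁, f₂, f₃, f₄⟩ := frame_mid p s t
    obtain ⟨f₅, f₆, f₇, f₈⟩ := frame_mid_nbr p s t
    obtain ⟨x, hx, fx⟩ : ∃ x : Space, (x = (-1 / 2, 0, 0) ∨ x = (0, -1 / 2, 0)) ∧
        f x = mid p e := by
      rcases het with rfl | rfl
      · exact ⟨_, Or.inl rfl, f₂⟩
      · exact ⟨_, Or.inr rfl, f₄⟩
    obtain ⟨y, hy, fy⟩ : ∃ y : Space, (y = (-1 / 2, 1, 0) ∨ y = (0, 3 / 2, 0)) ∧
        f y = mid (nbr p t) e' := by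
      rcases het' with rfl | rfl
      · exact ⟨_, Or.inl rfl, f₇⟩
      · exact ⟨_, Or.inr rfl, f₈⟩
    have hiso := (isotopic_push (R := f ⁻¹' R) hx hy ?_ ?_ ?_).image f hinj
    · simp only [Set.image_union, hR, image_segment, f, f₁, f₃, f₅, f₆] at hiso fx fy
      rw [fx, fy] at hiso
      convert hiso using 1
      · ext w
        rw [M.mem_link_iff p s t, b₂, b₄, ep, ep', curve_arcTile _ het₁, curve_arcTile _ het₁',
          chord_comm _ e']
        simp only [chord, mid_nbr_opp, Tile.curve, Set.mem_union, Set.mem_empty_iff_false, R,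
          Set.mem_ofPred_eq, false_or, or_false]
      · ext w
        rw [h.mem_link_iff, curve_arcTile _ he, curve_arcTile _ he', curve_arcTile _ hso.ne,
          curve_arcTile _ hsto.ne, chord_comm _ e', chord_comm _ _ t.opp]
        simp only [chord, mid_nbr_opp, mid_nbr_nbr, Set.mem_union, R, Set.mem_ofPred_eq]
        exact Iff.of_eq (by ac_rfl)
    · rintro w ⟨q, c₁, -, -, -, hq⟩ hw
      obtain ⟨a, ha, ea⟩ := hM.eq_mid c₁ hq ((frame_diamond p hst w).trans_le hw)
      rw [ep, meets_arcTile het₁] at ha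
      rcases ha with rfl | rfl
      · exact Or.inl (hinj (ea.trans fx.symm))
      · exact Or.inr (hinj (ea.trans f₃.symm))
    · rintro w ⟨q, -, -, c₃, -, hq⟩ hw
      -- The diamond of the second strand tile is handled in the reflected frame of that tile.
      have hw' := frame_diamond (nbr p t) hto (w.1, 1 - w.2.1, w.2.2)
      rw [frame_nbr_right] at hw'
      simp only [sub_sub_cancel] at hw'
      obtain ⟨a, ha, ea⟩ := hM.eq_mid c₃ hq (hw'.trans_le (by rwa [abs_sub_comm 1]))
      rw [ep', meets_arcTile het₁'] at ha
      rcases ha with rfl | rfl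
      · exact Or.inl (hinj (ea.trans fy.symm))
      · rw [mid_nbr_opp] at ea
        exact Or.inr (hinj (ea.trans f₃.symm))
    · rintro w ⟨q, c₁, c₂, c₃, c₄, hq⟩ hw
      rcases eq_of_mem_gap hst hw hq with rfl | rfl | rfl | rfl <;> contradiction
  · have hI : ¬ Tile.I.IsCrossing ∧ ¬ Tile.I.IsDouble := by decide
    refine h.forall_tile (P := fun x x' => (x'.IsCrossing ↔ x.IsCrossing) ∧
      (x'.IsDouble ↔ x.IsDouble) ∧ (x' = .I → x = .I)) (fun _ => by simp) ?_ ?_ ?_ ?_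
    · rw [ep]
      exact similar_arcTile (arcTile_type het₁).2.2 he
    · rw [b₂]
      exact similar_arcTile hI hso.ne
    · rw [ep']
      exact similar_arcTile (arcTile_type het₁').2.2 he'
    · rw [b₄]
      exact similar_arcTile hI hsto.ne
  · rw [h.tile₂]
    exact (arcTile_type hso.ne).2.1

/-- An arc needs two sides to end on, and only one is left. -/
lemma eq_I_of_not_meets {s t : Side} {x : Tile} : s.Perp t → x ≠ .dot → ¬ x.Meets s →
    ¬ x.Meets s.opp → ¬ x.Meets t → x = .I := by
  revert s t; cases x <;> decide

/-! ### Blank regions -/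

/-- In a mosaic that cannot be improved, two adjacent interior blank tiles are accompanied by blank
tiles on either side. -/
lemma blank_of_not_improvable {n : ℕ} {M : Mosaic n} (hM : M.IsLinkMosaic)
    (hn : ¬ M.Improvable) {q : Pos} {s t : Side} (hst : s.Perp t) (i₁ : q ∈ interior n)
    (i₂ : nbr q t ∈ interior n) (b₁ : M.tile q = .I) (b₂ : M.tile (nbr q t) = .I) :
    M.tile (nbr q s) = .I ∧ M.tile (nbr (nbr q s) t) = .I := by
  obtain ⟨p, rfl⟩ : ∃ p, q = nbr p s.opp := ⟨nbr q s, by simp⟩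
  rw [nbr_opp_nbr]
  have hso := hst.opp_left
  -- Otherwise a strand would pass along the two blank tiles and could be pushed into them. So there
  -- is a gap between these tiles and the pair at `p` and `nbr p t`.
  have m : ¬ (M.tile p).Meets t := fun h => hn (improvable_of_push hM hso i₁ i₂ b₁ b₂ h)
  have m' : ¬ (M.tile (nbr p t)).Meets t.opp := fun h => m ((hM p t).2 h)
  have n₁ : ¬ (M.tile p).Meets s.opp := fun h => not_meets_I s.opp.opp
    (b₁ ▸ (hM p s.opp).1 h)
  have n₂ : ¬ (M.tile (nbr p t)).Meets s.opp := fun h => not_meets_I s.opp.opp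
    (b₂ ▸ nbr_comm p s.opp t ▸ (hM _ s.opp).1 h)
  by_cases hi : p ∈ interior n ∧ nbr p t ∈ interior n
  · have i₃ : nbr (nbr p t) s.opp ∈ interior n := by rwa [nbr_comm]
    have b₃ : M.tile (nbr (nbr p t) s.opp) = .I := by rwa [nbr_comm]
    -- The first side in `improvable_of_kink` must be horizontal, which decides the order of the two
    -- sides at the corner.
    have hs : (s.opp = .left ∨ s.opp = .right) ∨ (t = .left ∨ t = .right) := by
      revert hst
      clear * -
      revert s t
      decide
    have k₁ := not_meets_I t
    have k₂ := not_meets_I t.opp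
    constructor
    · by_contra hp
      refine hn (hs.elim (fun hs => ?_) fun hs => ?_)
      · exact improvable_of_kink hM hso hs hi.1 i₁ hi.2 i₂ n₁ m (b₁ ▸ k₁) n₂ hp
      · exact improvable_of_kink hM hso.symm hs hi.1 hi.2 i₁ i₃ m n₁ n₂ (b₁ ▸ k₁) hp
    · by_contra hp
      refine hn (hs.elim (fun hs => ?_) fun hs => ?_)
      · exact improvable_of_kink hM hso.opp_right hs hi.2 i₃ (by simpa using hi.1)
          (by rw [nbr_comm, nbr_nbr_opp]; exact i₁) n₂ m' (b₃ ▸ k₂)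
          (by rwa [nbr_nbr_opp]) hp
      · have hs' : t.opp = .left ∨ t.opp = .right := by
          revert hs
          clear * -
          revert t
          decide
        exact improvable_of_kink hM hso.opp_right.symm hs' hi.2 (by simpa using hi.1) i₃
          (by rw [nbr_nbr_opp]; exact i₁) m' n₂ (by rwa [nbr_nbr_opp]) (b₃ ▸ k₂) hp
  -- Here the new pair lies along the boundary of the board, where no kink is needed: no arc can
  -- leave across the boundary, so a single side is left in each tile.
  · have hb : nbr p s ∉ board n ∧ nbr (nbr p s) t ∉ board n := by
      revert hi i₁ i₂ hst
      clear * -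
      cases s <;> cases t <;>
        simp [Side.Perp, Side.opp, nbr, interior, board] <;> omega
    constructor
    · exact eq_I_of_not_meets hst (M.ne_dot _)
        (fun h => not_meets_I s.opp (M.blank_outside _ hb.1 ▸ (hM p s).1 h)) n₁ m
    · exact eq_I_of_not_meets hst.opp_right (M.ne_dot _)
        (fun h => not_meets_I s.opp (M.blank_outside _ hb.2 ▸ nbr_comm p s t ▸ (hM _ s).1 h)) n₂ m'

lemma mem_interior {n : ℕ} {r c : ℤ} :
    (r, c) ∈ interior n ↔ (2 ≤ r ∧ r ≤ n - 1) ∧ 2 ≤ c ∧ c ≤ n - 1 := by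
  simp [interior]

lemma mem_board {n : ℕ} {r c : ℤ} :
    (r, c) ∈ board n ↔ (1 ≤ r ∧ r ≤ n) ∧ 1 ≤ c ∧ c ≤ n := by
  simp [board]

lemma rows_blank {n : ℕ} {M : Mosaic n} (hM : M.IsLinkMosaic) (hn : ¬ M.Improvable) {r c : ℤ}
    (i₁ : (r, c) ∈ interior n) (i₂ : (r + 1, c) ∈ interior n) (b₁ : M.tile (r, c) = .I)
    (b₂ : M.tile (r + 1, c) = .I) (c' : ℤ) :
    M.tile (r, c') = .I ∧ M.tile (r + 1, c') = .I := by
  rw [mem_interior] at i₁ i₂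
  rcases le_total c c' with h | h
  · induction c', h using Int.leInduction with
    | base => exact ⟨b₁, b₂⟩
    | succ k hk ih =>
      -- The last spreading step starts in the interior column `n - 1` and reaches the boundary
      -- column `n`; beyond that everything is blank by convention.
      by_cases hk' : k ≤ n - 1
      · exact blank_of_not_improvable hM hn (q := (r, k)) (s := .right) (t := .top) (by decide)
          (mem_interior.2 (by omega)) (mem_interior.2 (by dsimp only; omega)) ih.1 ih.2
      · exact ⟨M.blank_outside _ (by rw [mem_board]; omega),
          M.blank_outside _ (by rw [mem_board]; omega)⟩
  · induction c', h using Int.leInductionDown with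
    | base => exact ⟨b₁, b₂⟩
    | pred k hk ih =>
      by_cases hk' : 2 ≤ k
      · exact blank_of_not_improvable hM hn (q := (r, k)) (s := .left) (t := .top) (by decide)
          (mem_interior.2 (by omega)) (mem_interior.2 (by dsimp only; omega)) ih.1 ih.2
      · exact ⟨M.blank_outside _ (by rw [mem_board]; omega),
          M.blank_outside _ (by rw [mem_board]; omega)⟩

lemma columns_blank {n : ℕ} {M : Mosaic n} (hM : M.IsLinkMosaic) (hn : ¬ M.Improvable) {r c : ℤ}
    (i₁ : (r, c) ∈ interior n) (i₂ : (r, c + 1) ∈ interior n) (b₁ : M.tile (r, c) = .I)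
    (b₂ : M.tile (r, c + 1) = .I) (r' : ℤ) :
    M.tile (r', c) = .I ∧ M.tile (r', c + 1) = .I := by
  rw [mem_interior] at i₁ i₂
  rcases le_total r r' with h | h
  · induction r', h using Int.leInduction with
    | base => exact ⟨b₁, b₂⟩
    | succ k hk ih =>
      by_cases hk' : k ≤ n - 1
      · exact blank_of_not_improvable hM hn (q := (k, c)) (s := .top) (t := .right) (by decide)
          (mem_interior.2 (by omega)) (mem_interior.2 (by dsimp only; omega)) ih.1 ih.2
      · exact ⟨M.blank_outside _ (by rw [mem_board]; omega),
          M.blank_outside _ (by rw [mem_board]; omega)⟩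
  · induction r', h using Int.leInductionDown with
    | base => exact ⟨b₁, b₂⟩
    | pred k hk ih =>
      by_cases hk' : 2 ≤ k
      · exact blank_of_not_improvable hM hn (q := (k, c)) (s := .bottom) (t := .right) (by decide)
          (mem_interior.2 (by omega)) (mem_interior.2 (by dsimp only; omega)) ih.1 ih.2
      · exact ⟨M.blank_outside _ (by rw [mem_board]; omega),
          M.blank_outside _ (by rw [mem_board]; omega)⟩

/-- A mosaic with two vertically adjacent interior blank tiles that cannot be improved is blank. -/
lemma blank_of_domino {n : ℕ} {M : Mosaic n} (hM : M.IsLinkMosaic) (hn : ¬ M.Improvable)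
    (hn4 : 4 ≤ n) {r c : ℤ} (i₁ : (r, c) ∈ interior n) (i₂ : (r + 1, c) ∈ interior n)
    (b₁ : M.tile (r, c) = .I) (b₂ : M.tile (r + 1, c) = .I) (q : Pos) : M.tile q = .I := by
  have hr := rows_blank hM hn i₁ i₂ b₁ b₂
  rw [mem_interior] at i₁ i₂
  -- The two blank rows supply a blank horizontal pair in any two adjacent interior columns, from
  -- which these columns become blank. The same is then done for rows.
  have hc₀ : ∀ i j : ℤ, 2 ≤ j → j + 1 ≤ n - 1 → M.tile (i, j) = .I ∧ M.tile (i, j + 1) = .I :=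
    fun i j h h' => columns_blank hM hn (r := r) (mem_interior.2 (by omega))
      (mem_interior.2 (by omega)) (hr _).1 (hr _).1 i
  have hc : ∀ i j : ℤ, 2 ≤ j → j ≤ n - 1 → M.tile (i, j) = .I := by
    intro i j h h'
    by_cases hj : j + 1 ≤ n - 1
    · exact (hc₀ i j h hj).1
    · simpa using (hc₀ i (j - 1) (by omega) (by omega)).2
  have hr₀ : ∀ i j : ℤ, 2 ≤ i → i + 1 ≤ n - 1 → M.tile (i, j) = .I ∧ M.tile (i + 1, j) = .I :=
    fun i j h h' => rows_blank hM hn (c := 2) (mem_interior.2 (by omega))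
      (mem_interior.2 (by omega)) (hc _ _ (by omega) (by omega)) (hc _ _ (by omega) (by omega)) j
  have hr : ∀ i j : ℤ, 2 ≤ i → i ≤ n - 1 → M.tile (i, j) = .I := by
    intro i j h h'
    by_cases hi : i + 1 ≤ n - 1
    · exact (hr₀ i j h hi).1
    · simpa using (hr₀ (i - 1) j (by omega) (by omega)).2
  obtain ⟨i, j⟩ := q
  by_cases hi : 2 ≤ i ∧ i ≤ n - 1
  · exact hr i j hi.1 hi.2
  by_cases hj : 2 ≤ j ∧ j ≤ n - 1
  · exact hc i j hj.1 hj.2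
  -- Only the four corner tiles of the board remain, and all their neighbors are already known to be
  -- blank or lie outside.
  by_cases hb : (i, j) ∈ board n
  · rw [mem_board] at hb
    rw [Tile.eq_I_iff (M.ne_dot _)]
    intro s hs
    rw [hM] at hs
    refine not_meets_I s.opp ?_
    have hout : ∀ k l : ℤ, ¬ (1 ≤ k ∧ k ≤ n ∧ 1 ≤ l ∧ l ≤ n) → M.tile (k, l) = .I :=
      fun k l h => M.blank_outside _ (by rw [mem_board]; omega)
    have : M.tile (nbr (i, j) s) = .I := by
      cases s <;> dsimp only [nbr]
      · by_cases h : 2 ≤ j - 1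
        · exact hc _ _ h (by omega)
        · exact hout _ _ (by omega)
      · by_cases h : j + 1 ≤ n - 1
        · exact hc _ _ (by omega) h
        · exact hout _ _ (by omega)
      · by_cases h : 2 ≤ i - 1
        · exact hr _ _ h (by omega)
        · exact hout _ _ (by omega)
      · by_cases h : i + 1 ≤ n - 1
        · exact hr _ _ (by omega) h
        · exact hout _ _ (by omega)
    rwa [this] at hs
  · exact M.blank_outside _ hb

/-- A mosaic with a nonempty link can be improved if it has four interior tiles without arcs that end
on the sides at their common corner. -/
lemma improvable_of_gap {n : ℕ} {M : Mosaic n} (hM : M.IsLinkMosaic) (hl : M.link.Nonempty)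
    {r c : ℤ} (i₁ : (r, c) ∈ interior n) (i₂ : (r + 1, c + 1) ∈ interior n)
    (m₁ : ¬ (M.tile (r, c)).Meets .right) (m₂ : ¬ (M.tile (r, c)).Meets .top)
    (m₃ : ¬ (M.tile (r + 1, c + 1)).Meets .left) (m₄ : ¬ (M.tile (r + 1, c + 1)).Meets .bottom) :
    M.Improvable := by
  by_contra hn
  have j₁ := mem_interior.1 i₁
  have j₂ := mem_interior.1 i₂
  have i₃ : (r, c + 1) ∈ interior n := mem_interior.2 (by omega)
  have i₄ : (r + 1, c) ∈ interior n := mem_interior.2 (by omega)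
  -- Each side at the corner belongs to one of the two diagonal tiles, so connectedness passes the
  -- assumptions on to the other two.
  have m₅ : ¬ (M.tile (r, c + 1)).Meets .top := fun h => m₄ ((hM _ .top).1 h)
  have m₆ : ¬ (M.tile (r + 1, c)).Meets .right := fun h => m₃ ((hM _ .right).1 h)
  have m₇ : ¬ (M.tile (r + 1, c)).Meets .bottom := fun h => m₂ ((hM (r, c) .top).2 h)
  have b₁ : M.tile (r, c) = .I := by
    by_contra h
    exact hn (improvable_of_kink hM (p := (r, c)) (s := .right) (t := .top) (by decide)
      (Or.inr rfl) i₁ i₃ i₄ i₂ m₁ m₂ m₅ m₆ h)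
  have b₂ : M.tile (r + 1, c) = .I := by
    by_contra h
    exact hn (improvable_of_kink hM (p := (r + 1, c)) (s := .right) (t := .bottom) (by decide)
      (Or.inr rfl) i₄ i₂ (by simpa [nbr] using i₁) (by simpa [nbr] using i₃) m₆ m₇ m₄
      (by simpa [nbr] using m₁) h)
  have hb := blank_of_domino hM hn (by omega) i₁ i₄ b₁ b₂
  obtain ⟨w, hw⟩ := hl
  obtain ⟨q, hq⟩ := Set.mem_iUnion.1 hw
  rw [hb q] at hq
  exact hq

/-! ### Bubbles -/

lemma Loop.tile_pred {n : ℕ} {D : InteriorTiling n} (L : Loop D) (i : ZMod L.size) :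
    (L.tile (i - 1) : Pos) = nbr (L.tile i) (L.enter i) := by
  have h := L.tile_succ (i - 1)
  have h' := L.enter_succ (i - 1)
  rw [sub_add_cancel] at h h'
  rw [h, h', nbr_nbr_opp]

/-- A bubble runs around a common corner of four tiles. -/
lemma Loop.IsBubble.exists_corner {n : ℕ} {D : InteriorTiling n} {L : Loop D} (hL : L.IsBubble) :
    ∃ (r c : ℤ) (a b : interior n), (a : Pos) = (r, c) ∧ (b : Pos) = (r + 1, c + 1) ∧
      (D a).Joins .right .top ∧ (D b).Joins .left .bottom := by
  -- `Set.ncard` is 0 on infinite sets, so the value 4 gives finiteness.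
  have hfin : (Set.range L.tile).Finite :=
    Set.finite_of_ncard_ne_zero (by rw [show (Set.range L.tile).ncard = 4 from hL]; decide)
  obtain ⟨T, hT⟩ := hfin.exists_finset_coe
  have hcard : (T.map (Function.Embedding.subtype _)).card = 4 := by
    rw [Finset.card_map, ← Set.ncard_coe_finset, hT]
    exact hL
  have hmem : ∀ p : Pos, p ∈ T.map (Function.Embedding.subtype _) ↔
      ∃ i, (L.tile i : Pos) = p := by
    intro p
    have hT' : ∀ a, a ∈ T ↔ ∃ i, L.tile i = a := fun a => by
      rw [← Finset.mem_coe, hT, Set.mem_range]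
    simp only [Finset.mem_map, hT', Function.Embedding.subtype_apply]
    constructor
    · rintro ⟨_, ⟨i, rfl⟩, rfl⟩
      exact ⟨i, rfl⟩
    · rintro ⟨i, rfl⟩
      exact ⟨_, ⟨i, rfl⟩, rfl⟩
  generalize T.map (Function.Embedding.subtype _) = U at hcard hmem
  have hadj : ∀ p ∈ U, ∃ (a : interior n) (s s' : Side), (a : Pos) = p ∧ (D a).Joins s s' ∧
      nbr p s ∈ U ∧ nbr p s' ∈ U := by
    intro p hp
    obtain ⟨i, rfl⟩ := (hmem p).1 hp
    exact ⟨L.tile i, L.enter i, L.exit i, rfl, L.joins i, (hmem _).2 ⟨i - 1, L.tile_pred i⟩,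
      (hmem _).2 ⟨i + 1, L.tile_succ i⟩⟩
  -- The two ends of an arc are on different sides, so every tile of the bubble has at least two
  -- neighbors in it.
  have hadj' : ∀ p ∈ U, ∀ u : Side, ∃ s, s ≠ u ∧ nbr p s ∈ U := by
    intro p hp u
    obtain ⟨a, s, s', -, hj, h, h'⟩ := hadj p hp
    by_cases hs : s = u
    · exact ⟨s', fun e => hj.ne (hs.trans e.symm), h'⟩
    · exact ⟨s, hs, h⟩
  have hcorner : ∀ p ∈ U, ∀ {u v : Side}, u.Perp v → nbr p u.opp ∉ U → nbr p v.opp ∉ U →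
      nbr p u ∈ U ∧ nbr p v ∈ U ∧ ∃ a : interior n, (a : Pos) = p ∧ (D a).Joins u v := by
    intro p hp u v huv hu hv
    obtain ⟨a, s, s', ha, hj, h, h'⟩ := hadj p hp
    have h₁ : s ≠ u.opp := by rintro rfl; exact hu h
    have h₂ : s ≠ v.opp := by rintro rfl; exact hv h
    have h₃ : s' ≠ u.opp := by rintro rfl; exact hu h'
    have h₄ : s' ≠ v.opp := by rintro rfl; exact hv h'
    have : ∀ u v s s' : Side, u.Perp v → s ≠ u.opp → s ≠ v.opp → s' ≠ u.opp → s' ≠ v.opp →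
      s ≠ s' → s = u ∧ s' = v ∨ s = v ∧ s' = u := by decide
    rcases this u v s s' huv h₁ h₂ h₃ h₄ hj.ne with ⟨rfl, rfl⟩ | ⟨rfl, rfl⟩
    · exact ⟨h, h', a, ha, hj⟩
    · exact ⟨h', h, a, ha, hj.symm⟩
  -- A tile with maximal coordinate sum has no right or top neighbor in the bubble, so its arc joins
  -- left and bottom, and these two neighbors belong to the bubble.
  obtain ⟨⟨r, c⟩, hp, hmax⟩ := U.exists_max_image (fun p => p.1 + p.2)
    (Finset.card_pos.1 (by omega))
  have hnot : ∀ q : Pos, r + c < q.1 + q.2 → q ∉ U := fun q hq h => (hmax q h).not_gt hq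
  obtain ⟨h₁, h₂, b, hb, hjb⟩ := hcorner _ hp (u := .left) (v := .bottom) (by decide)
    (hnot _ (by dsimp [nbr, Side.opp]; omega)) (hnot _ (by dsimp [nbr, Side.opp]; omega))
  simp only [nbr] at h₁ h₂
  obtain ⟨x, hxU, hx⟩ : ∃ x ∈ U, x ∉ ({(r, c), (r, c - 1), (r - 1, c)} : Finset Pos) := by
    refine Finset.exists_mem_notMem_of_card_lt_card ?_
    rw [hcard]
    exact Finset.card_le_three.trans_lt (by decide)
  have hU : ∀ q ∈ U, q = (r, c) ∨ q = (r, c - 1) ∨ q = (r - 1, c) ∨ q = x := by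
    have hsub : insert x ({(r, c), (r, c - 1), (r - 1, c)} : Finset Pos) ⊆ U := by
      intro q
      simp only [Finset.mem_insert, Finset.mem_singleton]
      rintro (rfl | rfl | rfl | rfl) <;> assumption
    have heq := Finset.eq_of_subset_of_card_le hsub (by
      rw [hcard, Finset.card_insert_of_notMem hx, Finset.card_eq_three.2
        ⟨(r, c), (r, c - 1), (r - 1, c), by simp; omega, by simp; omega, by simp, rfl⟩])
    intro q hq
    rw [← heq] at hq
    simp only [Finset.mem_insert, Finset.mem_singleton] at hq
    tauto
  obtain ⟨x₁, x₂⟩ := x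
  -- Both of these neighbors need a second neighbor in the bubble. Only the fourth tile is
  -- available, and it must complete the square.
  have hx' : x₁ = r - 1 ∧ x₂ = c - 1 := by
    obtain ⟨s, hs, hsU⟩ := hadj' _ h₁ .right
    obtain ⟨s', hs', hsU'⟩ := hadj' _ h₂ .top
    have k := hU _ hsU
    have k' := hU _ hsU'
    cases s <;> cases s' <;> simp [nbr] at hs hs' k k' <;> omega
  obtain ⟨rfl, rfl⟩ := hx'
  obtain ⟨-, -, a, ha, hja⟩ := hcorner _ hxU (u := .right) (v := .top) (by decide)
    (fun h => by have := hU _ h; simp [nbr, Side.opp] at this; try omega)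
    (fun h => by have := hU _ h; simp [nbr, Side.opp] at this; try omega)
  exact ⟨r - 1, c - 1, a, b, ha, by simpa using hb, hja, hjb⟩

end KnotMosaic

/-! ### The theorem -/

theorem theorem3p5 (n : ℕ) (K : Set KnotMosaic.Space) (hK : KnotMosaic.IsKnot K)
    (M : KnotMosaic.Mosaic n) (D : KnotMosaic.InteriorTiling n) :
    (KnotMosaic.IsMinimal K M D → ¬ ∃ L : KnotMosaic.Loop D, L.IsBubble) ∧
      (M.IsMosaicFor K → KnotMosaic.IsDual M D → (∃ L : KnotMosaic.Loop D, L.IsBubble) →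
        ∃ (M' : KnotMosaic.Mosaic n) (D' : KnotMosaic.InteriorTiling n),
          M'.IsMosaicFor K ∧ KnotMosaic.IsDual M' D' ∧
            KnotMosaic.triple D' < KnotMosaic.triple D) := by
  have key : M.IsMosaicFor K → KnotMosaic.IsDual M D → (∃ L : KnotMosaic.Loop D, L.IsBubble) →
      ∃ (M' : KnotMosaic.Mosaic n) (D' : KnotMosaic.InteriorTiling n),
        M'.IsMosaicFor K ∧ KnotMosaic.IsDual M' D' ∧
          KnotMosaic.triple D' < KnotMosaic.triple D := by
    rintro ⟨hM, hMK⟩ hD ⟨L, hL⟩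
    obtain ⟨r, c, ⟨a, ha⟩, ⟨b, hb⟩, rfl, rfl, hja, hjb⟩ := hL.exists_corner
    -- Two diagonally opposite tiles of the bubble already account for all four sides at its center.
    have ma := (hD ⟨_, ha⟩).not_meets hja (by decide)
    have mb := (hD ⟨_, hb⟩).not_meets hjb (by decide)
    obtain ⟨M', hM', hiso, hs⟩ := KnotMosaic.improvable_of_gap hM
      (hMK.nonempty_iff.2 hK.nonempty) ha hb ma.1 ma.2 mb.1 mb.2
    obtain ⟨D', hD'⟩ := KnotMosaic.exists_isDual M'
    exact ⟨M', D', ⟨hM', hiso.symm.trans hMK⟩, hD', hs D' D hD' hD⟩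
  refine ⟨fun h hL => ?_, key⟩
  obtain ⟨M', D', h₁, h₂, h₃⟩ := key h.1 h.2.1 hL
  exact (h.2.2 M' D' h₁ h₂).not_gt h₃
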